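/- Let $K$ be a field. For a $K$-coalgebra $C$, the dual $C^*$ is an algebra under convolution $(f*g)(c)=\sum f(c_1)g(c_2)$, and $C$ is a left $C^*$-module via $f\cdot c=\sum f(c_2)c_1$. $C$ is called left co-Frobenius if it embeds in $C^*$ as a left $C^*$-module, and left quasi-co-Frobenius if it embeds in a free left $C^*$-module. (I) Let $\Gamma$ be a quiver and let $K\Gamma$ be its path coalgebra: it has the paths of $\Gamma$ (including the vertices, as paths of length $0$) as a basis, with $\Delta(p)=\sum_{qr=p}q\otimes r$, $\varepsilon(v)=1$ for every vertex $v$ and $\varepsilon(p)=0$ for every path $p$ of positive length; here $qr$ means $q$ followed by $r$. Let $C\subseteq K\Gamma$ be a path subcoalgebra, i.e. a subcoalgebra having a basis consisting of paths, and let $\mathcal B$ be the set of all paths in $C$. Let $R(C)$ (respectively $L(C)$) be the set of vertices $v\in C$ such that the set of paths in $\mathcal B$ starting (respectively ending) at $v$ is finite and contains a unique maximal path, where a path in this set is maximal if it has no proper extension $pr$ (respectively $rp$) in $\mathcal B$. For $v\in R(C)$ let $r(v)$ be the end of the maximal path starting at $v$; for $v\in L(C)$ let $l(v)$ be the start of the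 maximal path ending at $v$. Let $\mathcal F$ be the set of all paths $d$ in $\Gamma$ such that $d=qp$ for some $q,p\in\mathcal B$ and such that, for every factorization $d=qp$ with $q,p\in\mathcal B$: for any arrow $a$ with $ap\in\mathcal B$, the path $q$ ends with $a$; and for any arrow $b$ with $qb\in\mathcal B$, the path $p$ starts with $b$. Then the following are equivalent: (a) $C$ is left co-Frobenius; (b) $C$ is left quasi-co-Frobenius; (c) $R(C)$ consists of all vertices belonging to $C$, $r(R(C))\subseteq L(C)$, and $l(r(v))=v$ for every vertex $v$ in $C$; (d) for every $q\in\mathcal B$ there exists $p\in\mathcal B$, starting where $q$ ends, such that $qp\in\mathcal F$. (II) Let $X$ be a locally finite partially ordered set and let $KX$ be its incidence coalgebra: it has the segments $e_{x,y}$ ($x\le y$) as a basis, with $\Delta(e_{x,y})=\sum_{x\le z\le y}e_{x,z}\otimes e_{z,y}$ and $\varepsilon(e_{x,y})=\delta_{x,y}$. Let $C$ be any subcoalgebra of $KX$. Let $R(C)$ be the set of all $a\in X$ such that $e_{a,a}\in C$ and $\{x\mid a\le x,\ e_{a,x}\in C\}$ is finite with a unique maximal element, which is denoted by $r(a)$.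 Let $L(C)$ be the set of all $a\in X$ such that $e_{a,a}\in C$ and $\{x\mid x\le a,\ e_{x,a}\in C\}$ is finite with a unique minimal element, which is denoted by $l(a)$. For $x\le y$ let $U_{x,y}=\{u\mid x\le u\le y,\ e_{x,u}\in C,\ e_{u,y}\in C\}$, and let $u\sim v$ in $U_{x,y}$ if there are $n\ge1$, $u=u_0,u_1,\dots,u_n=v$ and $z_1,\dots,z_n$ in $U_{x,y}$ with $z_i\le u_{i-1}$ and $z_i\le u_i$ for $1\le i\le n$; this is an equivalence relation. Let $(U_{x,y}/\sim)_0$ be the set of equivalence classes $\mathcal C$ such that for all $u\in\mathcal C$ and $v\in X$: if $v\le u$ and $e_{v,y}\in C$, then $x\le v$; and if $u\le v$ and $e_{x,v}\in C$, then $v\le y$. Then the following are equivalent: (a) $C$ is left co-Frobenius; (b) $C$ is left quasi-co-Frobenius; (c) $R(C)=\{a\in X\mid e_{a,a}\in C\}$, $r(R(C))\subseteq L(C)$, and $l(r(a))=a$ for every $a\in X$ with $e_{a,a}\in C$; (d) for every segment $e_{x,z}\in C$ there exists $y\ge z$ such that $e_{z,y}\in C$ and the class of $z$ in $U_{x,y}/\sim$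 lies in $(U_{x,y}/\sim)_0$. -/

import Mathlib

open scoped TensorProduct

universe u v w x

/-! ### Modules over the dual algebra, and the (quasi-)co-Frobenius properties -/

section CoFrobenius

variable (K : Type w) [Field K] (C : Type x) [AddCommGroup C] [Module K C] [Coalgebra K C]

/-- The dual algebra `C*` of a coalgebra: linear forms with the convolution product
`(f * g)(c) = ∑ f(c₁) g(c₂)` and unit `ε`. -/
abbrev DualAlg : Type (max w x) := WithConv (C →ₗ[K] K)

/-- The left action of `C*` on `C`: `f ⇀ c = ∑ f(c₂) c₁`, as a bilinear map. -/
noncomputable def leftHit : (C →ₗ[K] K) →ₗ[K] C →ₗ[K] C where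
  toFun f := (TensorProduct.rid K C).toLinearMap ∘ₗ f.lTensor C ∘ₗ Coalgebra.comul
  map_add' f g := by ext c; simp
  map_smul' a f := by ext c; simp

theorem leftHit_repr {ι : Type*} (f : C →ₗ[K] K) (c : C) (r : Coalgebra.Repr K c ι) :
    leftHit K C f c = ∑ i ∈ r.index, f (r.right i) • r.left i := by
  simp [leftHit, ← r.eq]

theorem leftHit_mul (f g : DualAlg K C) (c : C) :
    leftHit K C (f * g).ofConv c = leftHit K C f.ofConv (leftHit K C g.ofConv c) := by
  have h := Coalgebra.coassoc_apply (R := K) c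
  have key : ∀ t : C ⊗[K] C,
      leftHit K C f.ofConv ((TensorProduct.rid K C) (g.ofConv.lTensor C t)) =
      TensorProduct.rid K C ((TensorProduct.rid K K).toLinearMap.lTensor C
        (TensorProduct.map LinearMap.id (TensorProduct.map f.ofConv g.ofConv)
          (TensorProduct.assoc K C C C (Coalgebra.comul.rTensor C t)))) := by
    intro t
    induction t with
    | zero => simp
    | add a b ha hb => simp only [map_add, ha, hb]
    | tmul a b =>
      simp only [LinearMap.lTensor_tmul, TensorProduct.rid_tmul, map_smul,
        LinearMap.rTensor_tmul, leftHit, LinearMap.coe_mk, AddHom.coe_mk, LinearMap.comp_apply,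
        LinearEquiv.coe_coe]
      generalize (Coalgebra.comul (R := K) a) = s
      induction s with
      | zero => simp
      | add a b ha hb => simp only [map_add, ha, hb, smul_add, TensorProduct.add_tmul]
      | tmul p q => simp [← mul_smul, mul_comm]
  have h2 : leftHit K C g.ofConv c =
      (TensorProduct.rid K C) (g.ofConv.lTensor C (Coalgebra.comul c)) := rfl
  rw [h2, key, h]
  have key2 : ∀ t : C ⊗[K] C,
      (TensorProduct.rid K C) ((f * g).ofConv.lTensor C t) =
      TensorProduct.rid K C ((TensorProduct.rid K K).toLinearMap.lTensor C
        (TensorProduct.map LinearMap.id (TensorProduct.map f.ofConv g.ofConv)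
          (Coalgebra.comul.lTensor C t))) := by
    intro t
    induction t with
    | zero => simp
    | add a b ha hb => simp only [map_add, ha, hb]
    | tmul a b =>
      have e : (f * g).ofConv b =
        LinearMap.mul' K K (TensorProduct.map f.ofConv g.ofConv (Coalgebra.comul b)) := rfl
      simp only [LinearMap.lTensor_tmul, TensorProduct.rid_tmul, TensorProduct.map_tmul, e]
      generalize (Coalgebra.comul (R := K) b) = s
      induction s with
      | zero => simp
      | add a b ha hb => simp only [map_add, add_smul, ha, hb]
      | tmul p q => simp [mul_comm]
  exact key2 _

/-- The canonical left `C*`-module structure on `C`, with `f • c = ∑ f(c₂) c₁`. -/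
@[reducible] noncomputable def leftDualModule : Module (DualAlg K C) C where
  smul f c := leftHit K C f.ofConv c
  one_smul c := by
    change (TensorProduct.rid K C) ((Algebra.linearMap K K ∘ₗ Coalgebra.counit).lTensor C
      (Coalgebra.comul c)) = c
    have : (Algebra.linearMap K K ∘ₗ Coalgebra.counit : C →ₗ[K] K) = Coalgebra.counit := by
      ext; simp
    rw [this]
    simp
  mul_smul f g c := leftHit_mul K C f g c
  smul_zero f := map_zero _
  smul_add f a b := map_add _ a b
  add_smul f g c := by
    change leftHit K C (f.ofConv + g.ofConv) c = _
    rw [map_add]; rfl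
  zero_smul c := by
    change leftHit K C 0 c = 0
    rw [map_zero]; rfl

/-- `C` is left co-Frobenius: `C` embeds in `C*` as a left `C*`-module. -/
def IsLeftCoFrobenius : Prop :=
  letI := leftDualModule K C
  ∃ φ : C →ₗ[DualAlg K C] DualAlg K C, Function.Injective φ

/-- `C` is left quasi-co-Frobenius: `C` embeds in a free left `C*`-module, i.e. in a direct sum of
copies of `C*`. -/
def IsLeftQuasiCoFrobenius : Prop :=
  letI := leftDualModule K C
  ∃ (ι : Type x) (φ : C →ₗ[DualAlg K C] (ι →₀ DualAlg K C)), Function.Injective φ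

end CoFrobenius

/-! ### Subcoalgebras -/

/-- A subcoalgebra of `D`: a subspace `C` with `Δ(C) ⊆ C ⊗ C` (inside `D ⊗ D`). -/
structure Subcoalgebra (K : Type w) [Field K] (D : Type x) [AddCommGroup D] [Module K D]
    [Coalgebra K D] where
  /-- the underlying subspace -/
  toSubmodule : Submodule K D
  comul_mem : ∀ c ∈ toSubmodule, Coalgebra.comul (R := K) c ∈
    LinearMap.range (TensorProduct.map toSubmodule.subtype toSubmodule.subtype)

namespace Subcoalgebra

variable {K : Type w} [Field K] {D : Type x} [AddCommGroup D] [Module K D] [Coalgebra K D]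

/-- The underlying vector space of a subcoalgebra. -/
abbrev Carrier (C : Subcoalgebra K D) : Type x := C.toSubmodule

variable (C : Subcoalgebra K D)

theorem incl_injective :
    Function.Injective (TensorProduct.map C.toSubmodule.subtype C.toSubmodule.subtype) :=
  TensorProduct.map_injective_of_flat_flat _ _
    C.toSubmodule.injective_subtype C.toSubmodule.injective_subtype

/-- The restricted comultiplication `C → C ⊗ C`. -/
noncomputable def comulRestrict : C.Carrier →ₗ[K] C.Carrier ⊗[K] C.Carrier :=
  (LinearEquiv.ofInjective _ C.incl_injective).symm.toLinearMap ∘ₗ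
    LinearMap.codRestrict _ (Coalgebra.comul ∘ₗ C.toSubmodule.subtype)
      (fun c => C.comul_mem c c.2)

theorem incl_comulRestrict (c : C.Carrier) :
    TensorProduct.map C.toSubmodule.subtype C.toSubmodule.subtype (C.comulRestrict c) =
      Coalgebra.comul (c : D) := by
  have h := LinearEquiv.apply_symm_apply (LinearEquiv.ofInjective _ C.incl_injective)
    (LinearMap.codRestrict _ (Coalgebra.comul ∘ₗ C.toSubmodule.subtype)
      (fun c => C.comul_mem c c.2) c)
  exact congrArg Subtype.val h

/-- A subcoalgebra is a coalgebra with the restricted operations. -/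
noncomputable instance : Coalgebra K C.Carrier where
  comul := C.comulRestrict
  counit := Coalgebra.counit ∘ₗ C.toSubmodule.subtype
  coassoc := by
    have inj : Function.Injective (TensorProduct.map C.toSubmodule.subtype
        (TensorProduct.map C.toSubmodule.subtype C.toSubmodule.subtype)) :=
      TensorProduct.map_injective_of_flat_flat _ _
        C.toSubmodule.injective_subtype C.incl_injective
    have e : TensorProduct.map C.toSubmodule.subtype C.toSubmodule.subtype ∘ₗ C.comulRestrict =
        Coalgebra.comul ∘ₗ C.toSubmodule.subtype := LinearMap.ext C.incl_comulRestrict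
    refine LinearMap.ext fun c => inj ?_
    have h1 : ∀ t : C.Carrier ⊗[K] C.Carrier,
        TensorProduct.map C.toSubmodule.subtype
          (TensorProduct.map C.toSubmodule.subtype C.toSubmodule.subtype)
          (TensorProduct.assoc K _ _ _ (C.comulRestrict.rTensor _ t)) =
        TensorProduct.assoc K _ _ _ (Coalgebra.comul.rTensor D
          (TensorProduct.map C.toSubmodule.subtype C.toSubmodule.subtype t)) := by
      intro t
      induction t with
      | zero => simp
      | add a b ha hb => simp only [map_add, ha, hb]
      | tmul a b =>
        simp only [LinearMap.rTensor_tmul, TensorProduct.map_tmul, Submodule.subtype_apply,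
          ← C.incl_comulRestrict]
        generalize C.comulRestrict a = s
        induction s with
        | zero => simp
        | add a b ha hb => simp only [map_add, TensorProduct.add_tmul, ha, hb]
        | tmul p q => simp
    have h2 : ∀ t : C.Carrier ⊗[K] C.Carrier,
        TensorProduct.map C.toSubmodule.subtype
          (TensorProduct.map C.toSubmodule.subtype C.toSubmodule.subtype)
          (C.comulRestrict.lTensor _ t) =
        Coalgebra.comul.lTensor D
          (TensorProduct.map C.toSubmodule.subtype C.toSubmodule.subtype t) := by
      intro t
      induction t with
      | zero => simp
      | add a b ha hb => simp only [map_add, ha, hb]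
      | tmul a b =>
        simp only [LinearMap.lTensor_tmul, TensorProduct.map_tmul, Submodule.subtype_apply,
          ← C.incl_comulRestrict]
    change TensorProduct.map _ _ (TensorProduct.assoc K _ _ _
      (C.comulRestrict.rTensor _ (C.comulRestrict c))) =
      TensorProduct.map _ _ (C.comulRestrict.lTensor _ (C.comulRestrict c))
    rw [h1, h2, C.incl_comulRestrict]
    exact Coalgebra.coassoc_apply (c : D)
  rTensor_counit_comp_comul := by
    have inj : Function.Injective (C.toSubmodule.subtype.lTensor K) :=
      Module.Flat.lTensor_preserves_injective_linearMap _ C.toSubmodule.injective_subtype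
    refine LinearMap.ext fun c => inj ?_
    have h1 : ∀ t : C.Carrier ⊗[K] C.Carrier,
        C.toSubmodule.subtype.lTensor K
          ((Coalgebra.counit ∘ₗ C.toSubmodule.subtype).rTensor _ t) =
        Coalgebra.counit.rTensor D
          (TensorProduct.map C.toSubmodule.subtype C.toSubmodule.subtype t) := by
      intro t
      induction t with
      | zero => simp
      | add a b ha hb => simp only [map_add, ha, hb]
      | tmul a b => simp
    change C.toSubmodule.subtype.lTensor K
      ((Coalgebra.counit ∘ₗ C.toSubmodule.subtype).rTensor _ (C.comulRestrict c)) = _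
    rw [h1, C.incl_comulRestrict]
    simp
  lTensor_counit_comp_comul := by
    have inj : Function.Injective (C.toSubmodule.subtype.rTensor K) :=
      Module.Flat.rTensor_preserves_injective_linearMap _ C.toSubmodule.injective_subtype
    refine LinearMap.ext fun c => inj ?_
    have h1 : ∀ t : C.Carrier ⊗[K] C.Carrier,
        C.toSubmodule.subtype.rTensor K
          ((Coalgebra.counit ∘ₗ C.toSubmodule.subtype).lTensor _ t) =
        Coalgebra.counit.lTensor D
          (TensorProduct.map C.toSubmodule.subtype C.toSubmodule.subtype t) := by
      intro t
      induction t with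
      | zero => simp
      | add a b ha hb => simp only [map_add, ha, hb]
      | tmul a b => simp
    change C.toSubmodule.subtype.rTensor K
      ((Coalgebra.counit ∘ₗ C.toSubmodule.subtype).lTensor _ (C.comulRestrict c)) = _
    rw [h1, C.incl_comulRestrict]
    simp

end Subcoalgebra

/-! ### Path coalgebras -/

section PathCoalgebra

/-- All paths of a quiver, of any source, target and length. -/
abbrev TotalPath (V : Type u) [Quiver.{v} V] : Type (max u v) :=
  Σ a b : V, Quiver.Path a b

/-- The path coalgebra `KΓ`: the vector space with basis all paths of `Γ`. -/
def PathCoalgebra (K : Type w) [Field K] (V : Type u) [Quiver.{v} V] : Type (max u v w) :=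
  TotalPath V →₀ K

variable (K : Type w) [Field K] (V : Type u) [Quiver.{v} V]

noncomputable instance : AddCommGroup (PathCoalgebra K V) :=
  inferInstanceAs (AddCommGroup (TotalPath V →₀ K))

noncomputable instance : Module K (PathCoalgebra K V) :=
  inferInstanceAs (Module K (TotalPath V →₀ K))

/-- The basis of `KΓ` consisting of the paths. -/
noncomputable def pathBasis : Module.Basis (TotalPath V) K (PathCoalgebra K V) :=
  Module.Basis.ofRepr (LinearEquiv.refl K (TotalPath V →₀ K))

variable {V}

/-- The basis element of `KΓ` given by a path. -/
noncomputable def pathElem {a b : V} (p : Quiver.Path a b) : PathCoalgebra K V :=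
  pathBasis K V ⟨a, b, p⟩

/-- All factorizations `p = q r` of a path, each listed exactly once. -/
def pathSplits {a : V} : ∀ {b : V}, Quiver.Path a b →
    List (Σ c : V, Quiver.Path a c × Quiver.Path c b)
  | _, .nil => [⟨a, .nil, .nil⟩]
  | _, .cons p e => ((pathSplits p).map fun s => ⟨s.1, s.2.1, s.2.2.cons e⟩) ++
      [⟨_, p.cons e, .nil⟩]

theorem mem_pathSplits {a b : V} (p : Quiver.Path a b)
    (s : Σ c : V, Quiver.Path a c × Quiver.Path c b) :
    s ∈ pathSplits p ↔ s.2.1.comp s.2.2 = p := by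
  induction p with
  | nil =>
    obtain ⟨c, q, r⟩ := s
    simp only [pathSplits, List.mem_singleton]
    constructor
    · intro h; cases h; rfl
    · intro h
      cases r with
      | nil => cases h; rfl
      | cons r e => exact absurd h (Quiver.Path.cons_ne_nil _ _)
  | cons p e ih =>
    simp only [pathSplits, List.mem_append, List.mem_map, List.mem_singleton]
    constructor
    · rintro (⟨t, ht, h⟩ | h)
      · subst h
        have := (ih t).1 ht
        simp [this]
      · subst h; rfl
    · obtain ⟨c, q, r⟩ := s
      intro h
      cases r with
      | nil =>
        right
        change q = _ at h
        subst h
        rfl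
      | cons r f =>
        left
        simp only [Quiver.Path.comp_cons] at h
        cases h
        exact ⟨⟨c, q, r⟩, (ih _).2 rfl, rfl⟩

theorem nodup_pathSplits {a b : V} (p : Quiver.Path a b) : (pathSplits p).Nodup := by
  induction p with
  | nil => simp [pathSplits]
  | cons p e ih =>
    simp only [pathSplits]
    refine List.Nodup.append (ih.map ?_) (List.nodup_singleton _) ?_
    · rintro ⟨c, q, r⟩ ⟨c', q', r'⟩ h
      cases h
      rfl
    · intro s hs hs'
      rw [List.mem_singleton] at hs'
      subst hs'
      obtain ⟨t, -, h⟩ := List.mem_map.1 hs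
      have := congrArg (fun s => s.2.2.length) h
      simp at this

theorem sum_pathSplits_coassoc {M : Type*} [AddCommMonoid M] {a b : V} (p : Quiver.Path a b)
    (f : ∀ c d : V, Quiver.Path a c → Quiver.Path c d → Quiver.Path d b → M) :
    ((pathSplits p).map fun s =>
      ((pathSplits s.2.1).map fun t => f t.1 s.1 t.2.1 t.2.2 s.2.2).sum).sum =
    ((pathSplits p).map fun s =>
      ((pathSplits s.2.2).map fun t => f s.1 t.1 s.2.1 t.2.1 t.2.2).sum).sum := by
  induction p with
  | nil => simp [pathSplits]
  | cons p e ih =>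
    have := ih (fun c d q r t => f c d q r (t.cons e))
    simp only [pathSplits, List.map_append, List.map_map, List.sum_append, List.map_cons,
      List.map_nil, List.sum_cons, List.sum_nil, add_zero, Function.comp_def,
      List.sum_map_add] at this ⊢
    rw [this, add_assoc]

theorem sum_pathSplits_left {M : Type*} [AddCommMonoid M] {a b : V} (p : Quiver.Path a b)
    (f : ∀ c : V, Quiver.Path c b → M) :
    ((pathSplits p).map fun s => if s.2.1.length = 0 then f s.1 s.2.2 else 0).sum = f a p := by
  induction p with
  | nil => simp [pathSplits]
  | cons p e ih =>
    have := ih (fun c q => f c (q.cons e))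
    simp only [pathSplits, List.map_append, List.map_map, List.sum_append, List.map_cons,
      List.map_nil, List.sum_cons, List.sum_nil, add_zero, Function.comp_def] at this ⊢
    rw [this]
    simp

theorem sum_pathSplits_right {M : Type*} [AddCommMonoid M] {a b : V} (p : Quiver.Path a b)
    (f : ∀ c : V, Quiver.Path a c → M) :
    ((pathSplits p).map fun s => if s.2.2.length = 0 then f s.1 s.2.1 else 0).sum = f b p := by
  cases p with
  | nil => simp [pathSplits]
  | cons p e =>
    simp [pathSplits, Function.comp_def]

variable (V)

/-- `Δ(p) = ∑_{qr = p} q ⊗ r`. -/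
noncomputable def pathComul :
    PathCoalgebra K V →ₗ[K] PathCoalgebra K V ⊗[K] PathCoalgebra K V :=
  (pathBasis K V).constr K fun p =>
    ((pathSplits p.2.2).map fun s => pathElem K s.2.1 ⊗ₜ[K] pathElem K s.2.2).sum

/-- `ε(v) = 1` for vertices, `ε(p) = 0` for paths of positive length. -/
noncomputable def pathCounit : PathCoalgebra K V →ₗ[K] K :=
  (pathBasis K V).constr K fun p => if p.2.2.length = 0 then 1 else 0

variable {V}

theorem pathComul_pathElem {a b : V} (p : Quiver.Path a b) :
    pathComul K V (pathElem K p) =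
      ((pathSplits p).map fun s => pathElem K s.2.1 ⊗ₜ[K] pathElem K s.2.2).sum := by
  simp [pathComul, pathElem]

theorem pathCounit_pathElem {a b : V} (p : Quiver.Path a b) :
    pathCounit K V (pathElem K p) = if p.length = 0 then 1 else 0 := by
  simp [pathCounit, pathElem]

variable (V)

noncomputable instance : Coalgebra K (PathCoalgebra K V) where
  comul := pathComul K V
  counit := pathCounit K V
  coassoc := by
    refine (pathBasis K V).ext fun ⟨a, b, p⟩ => ?_
    change TensorProduct.assoc K _ _ _ ((pathComul K V).rTensor _
      (pathComul K V (pathElem K p))) = (pathComul K V).lTensor _ (pathComul K V (pathElem K p))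
    have := sum_pathSplits_coassoc p
      (fun c d q r t => pathElem K q ⊗ₜ[K] (pathElem K r ⊗ₜ[K] pathElem K t))
    have hl : ∀ (l : List (Σ c : V, Quiver.Path a c × Quiver.Path c b)),
        TensorProduct.assoc K _ _ _ ((pathComul K V).rTensor _
          (l.map fun s => pathElem K s.2.1 ⊗ₜ[K] pathElem K s.2.2).sum) =
        (l.map fun s => ((pathSplits s.2.1).map fun t =>
          pathElem K t.2.1 ⊗ₜ[K] (pathElem K t.2.2 ⊗ₜ[K] pathElem K s.2.2)).sum).sum := by
      intro l
      induction l with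
      | nil => simp
      | cons s l ih =>
        simp only [List.map_cons, List.sum_cons, map_add, ih, LinearMap.rTensor_tmul,
          pathComul_pathElem]
        congr 1
        generalize pathSplits s.2.1 = m
        induction m with
        | nil => simp
        | cons t m ih => simp [TensorProduct.add_tmul, ← ih]
    have hr : ∀ (l : List (Σ c : V, Quiver.Path a c × Quiver.Path c b)),
        (pathComul K V).lTensor _
          (l.map fun s => pathElem K s.2.1 ⊗ₜ[K] pathElem K s.2.2).sum =
        (l.map fun s => ((pathSplits s.2.2).map fun t =>
          pathElem K s.2.1 ⊗ₜ[K] (pathElem K t.2.1 ⊗ₜ[K] pathElem K t.2.2)).sum).sum := by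
      intro l
      induction l with
      | nil => simp
      | cons s l ih =>
        simp only [List.map_cons, List.sum_cons, map_add, ih, LinearMap.lTensor_tmul,
          pathComul_pathElem]
        congr 1
        generalize pathSplits s.2.2 = m
        induction m with
        | nil => simp
        | cons t m ih => simp [TensorProduct.tmul_add, ← ih]
    rw [pathComul_pathElem, hl, hr, this]
  rTensor_counit_comp_comul := by
    refine (pathBasis K V).ext fun ⟨a, b, p⟩ => ?_
    change (pathCounit K V).rTensor _ (pathComul K V (pathElem K p)) = 1 ⊗ₜ[K] pathElem K p
    rw [pathComul_pathElem, map_list_sum, List.map_map,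
      ← sum_pathSplits_left p (fun c q => (1 : K) ⊗ₜ[K] pathElem K q)]
    congr 2
    funext s
    simp only [Function.comp_apply, LinearMap.rTensor_tmul, pathCounit_pathElem]
    split_ifs <;> simp
  lTensor_counit_comp_comul := by
    refine (pathBasis K V).ext fun ⟨a, b, p⟩ => ?_
    change (pathCounit K V).lTensor _ (pathComul K V (pathElem K p)) = pathElem K p ⊗ₜ[K] 1
    rw [pathComul_pathElem, map_list_sum, List.map_map,
      ← sum_pathSplits_right p (fun c q => pathElem K q ⊗ₜ[K] (1 : K))]
    congr 2
    funext s
    simp only [Function.comp_apply, LinearMap.lTensor_tmul, pathCounit_pathElem]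
    split_ifs <;> simp

end PathCoalgebra

/-! ### Combinatorics of path subcoalgebras -/

namespace PathSub

variable {K : Type w} [Field K] {V : Type u} [Quiver.{v} V]
  (C : Subcoalgebra K (PathCoalgebra K V))

/-- The path `p` lies in `C`, i.e. `p ∈ 𝓑`. -/
def Mem {a b : V} (p : Quiver.Path a b) : Prop := pathElem K p ∈ C.toSubmodule

/-- `C` is a path subcoalgebra: it is spanned by a set of paths (which are then a basis of `C`,
since paths are linearly independent). -/
def IsPathSubcoalgebra : Prop :=
  ∃ S : Set (TotalPath V), C.toSubmodule = Submodule.span K (pathBasis K V '' S)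

/-- The vertices in `C`. -/
def vertices : Set V := {a | Mem C (Quiver.Path.nil : Quiver.Path a a)}

/-- The paths of `C` starting at `a`. -/
def pathsFrom (a : V) : Set (Σ b : V, Quiver.Path a b) := {p | Mem C p.2}

/-- The paths of `C` ending at `b`. -/
def pathsTo (b : V) : Set (Σ a : V, Quiver.Path a b) := {p | Mem C p.2}

/-- `p` is maximal among the paths of `C` starting at `a`: the only path `p r` in `C` is `p`. -/
def IsMaxFrom (a : V) (p : Σ b : V, Quiver.Path a b) : Prop :=
  p ∈ pathsFrom C a ∧
    ∀ q ∈ pathsFrom C a, (∃ r : Quiver.Path p.1 q.1, p.2.comp r = q.2) → q = p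

/-- `p` is maximal among the paths of `C` ending at `b`: the only path `r p` in `C` is `p`. -/
def IsMaxTo (b : V) (p : Σ a : V, Quiver.Path a b) : Prop :=
  p ∈ pathsTo C b ∧
    ∀ q ∈ pathsTo C b, (∃ r : Quiver.Path q.1 p.1, r.comp p.2 = q.2) → q = p

/-- `R(C)`: the vertices of `C` from which only finitely many paths of `C` start, with a unique
maximal one among them. -/
def R : Set V := {a | a ∈ vertices C ∧ (pathsFrom C a).Finite ∧ ∃! p, IsMaxFrom C a p}

/-- `L(C)`: the vertices of `C` at which only finitely many paths of `C` end, with a unique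
maximal one among them. -/
def L : Set V := {b | b ∈ vertices C ∧ (pathsTo C b).Finite ∧ ∃! p, IsMaxTo C b p}

/-- `r(v)`, the end of the maximal path of `C` starting at `v ∈ R(C)`. -/
noncomputable def r (a : R C) : V := a.2.2.2.exists.choose.1

/-- `l(v)`, the start of the maximal path of `C` ending at `v ∈ L(C)`. -/
noncomputable def l (b : L C) : V := b.2.2.2.exists.choose.1

/-- The set `𝓕`: the paths `d` that are products `q p` of two paths of `C`, such that for each
such factorization and all arrows `α`, `β`: if `α p ∈ C` then `q` ends with `α`,
and if `q β ∈ C` then `p` starts with `β`. -/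
def InF {a b : V} (d : Quiver.Path a b) : Prop :=
  (∃ (c : V) (q : Quiver.Path a c) (p : Quiver.Path c b), Mem C q ∧ Mem C p ∧ q.comp p = d) ∧
  (∀ (c : V) (q : Quiver.Path a c) (p : Quiver.Path c b), Mem C q → Mem C p → q.comp p = d →
    ∀ (e : V) (α : e ⟶ c), Mem C (α.toPath.comp p) → ∃ q' : Quiver.Path a e, q = q'.cons α) ∧
  (∀ (c : V) (q : Quiver.Path a c) (p : Quiver.Path c b), Mem C q → Mem C p → q.comp p = d →
    ∀ (e : V) (β : c ⟶ e), Mem C (q.cons β) → ∃ p' : Quiver.Path e b, p = β.toPath.comp p')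

end PathSub

/-! ### Incidence coalgebras -/

section IncidenceCoalgebra

/-- The incidence coalgebra `KX`: the vector space with basis the segments `e_{x,y}`, `x ≤ y`. -/
def IncidenceCoalgebra (K : Type w) [Field K] (X : Type u) [PartialOrder X] : Type (max u w) :=
  {p : X × X // p.1 ≤ p.2} →₀ K

variable (K : Type w) [Field K] (X : Type u) [PartialOrder X]

noncomputable instance : AddCommGroup (IncidenceCoalgebra K X) :=
  inferInstanceAs (AddCommGroup ({p : X × X // p.1 ≤ p.2} →₀ K))

noncomputable instance : Module K (IncidenceCoalgebra K X) :=
  inferInstanceAs (Module K ({p : X × X // p.1 ≤ p.2} →₀ K))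

/-- The basis of `KX` consisting of the segments. -/
noncomputable def segBasis :
    Module.Basis {p : X × X // p.1 ≤ p.2} K (IncidenceCoalgebra K X) :=
  Module.Basis.ofRepr (LinearEquiv.refl K ({p : X × X // p.1 ≤ p.2} →₀ K))

variable {X}

/-- The segment `e_{x,y}` as an element of `KX`. -/
noncomputable def seg {x y : X} (h : x ≤ y) : IncidenceCoalgebra K X := segBasis K X ⟨(x, y), h⟩

variable (X)

open scoped Classical in
/-- `ε(e_{x,y}) = δ_{x,y}`. -/
noncomputable def segCounit : IncidenceCoalgebra K X →ₗ[K] K :=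
  (segBasis K X).constr K fun p => if p.1.1 = p.1.2 then 1 else 0

variable {X}

open scoped Classical in
theorem segCounit_seg {x y : X} (h : x ≤ y) :
    segCounit K X (seg K h) = if x = y then 1 else 0 := by
  simp [segCounit, seg]

variable (X) [LocallyFiniteOrder X]

/-- `Δ(e_{x,y}) = ∑_{x ≤ z ≤ y} e_{x,z} ⊗ e_{z,y}`. -/
noncomputable def segComul :
    IncidenceCoalgebra K X →ₗ[K] IncidenceCoalgebra K X ⊗[K] IncidenceCoalgebra K X :=
  (segBasis K X).constr K fun p => ∑ z ∈ (Finset.Icc p.1.1 p.1.2).attach,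
    seg K (Finset.mem_Icc.1 z.2).1 ⊗ₜ[K] seg K (Finset.mem_Icc.1 z.2).2

variable {X}

theorem segComul_seg {x y : X} (h : x ≤ y) :
    segComul K X (seg K h) = ∑ z ∈ (Finset.Icc x y).attach,
      seg K (Finset.mem_Icc.1 z.2).1 ⊗ₜ[K] seg K (Finset.mem_Icc.1 z.2).2 := by
  simp [segComul, seg]

variable (X)

noncomputable instance : Coalgebra K (IncidenceCoalgebra K X) where
  comul := segComul K X
  counit := segCounit K X
  coassoc := by
    refine (segBasis K X).ext fun ⟨⟨x, y⟩, h⟩ => ?_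
    change TensorProduct.assoc K _ _ _ ((segComul K X).rTensor _
      (segComul K X (seg K h))) = (segComul K X).lTensor _ (segComul K X (seg K h))
    simp only [segComul_seg, map_sum, LinearMap.rTensor_tmul, LinearMap.lTensor_tmul,
      TensorProduct.sum_tmul, TensorProduct.tmul_sum, TensorProduct.assoc_tmul]
    rw [Finset.sum_sigma', Finset.sum_sigma']
    refine Finset.sum_bij'
      (fun s _ => ⟨⟨s.2.1, ?_⟩, ⟨s.1.1, ?_⟩⟩) (fun s _ => ⟨⟨s.2.1, ?_⟩, ⟨s.1.1, ?_⟩⟩)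
      ?_ ?_ ?_ ?_ ?_
    · have h1 := Finset.mem_Icc.1 s.1.2
      have h2 := Finset.mem_Icc.1 s.2.2
      exact Finset.mem_Icc.2 ⟨h2.1, h2.2.trans h1.2⟩
    · have h1 := Finset.mem_Icc.1 s.1.2
      have h2 := Finset.mem_Icc.1 s.2.2
      exact Finset.mem_Icc.2 ⟨h2.2, h1.2⟩
    · have h1 := Finset.mem_Icc.1 s.1.2
      have h2 := Finset.mem_Icc.1 s.2.2
      exact Finset.mem_Icc.2 ⟨h1.1.trans h2.1, h2.2⟩
    · have h1 := Finset.mem_Icc.1 s.1.2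
      have h2 := Finset.mem_Icc.1 s.2.2
      exact Finset.mem_Icc.2 ⟨h1.1, h2.1⟩
    all_goals simp
  rTensor_counit_comp_comul := by
    refine (segBasis K X).ext fun ⟨⟨x, y⟩, h⟩ => ?_
    change (segCounit K X).rTensor _ (segComul K X (seg K h)) = 1 ⊗ₜ[K] seg K h
    simp only [segComul_seg, map_sum, LinearMap.rTensor_tmul, segCounit_seg]
    rw [Finset.sum_eq_single ⟨x, Finset.mem_Icc.2 ⟨le_rfl, h⟩⟩]
    · simp
    · rintro ⟨z, hz⟩ - hne
      have : x ≠ z := fun e => hne (by subst e; rfl)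
      simp [this]
    · simp
  lTensor_counit_comp_comul := by
    refine (segBasis K X).ext fun ⟨⟨x, y⟩, h⟩ => ?_
    change (segCounit K X).lTensor _ (segComul K X (seg K h)) = seg K h ⊗ₜ[K] 1
    simp only [segComul_seg, map_sum, LinearMap.lTensor_tmul, segCounit_seg]
    rw [Finset.sum_eq_single ⟨y, Finset.mem_Icc.2 ⟨h, le_rfl⟩⟩]
    · simp
    · rintro ⟨z, hz⟩ - hne
      have : z ≠ y := fun e => hne (by subst e; rfl)
      simp [this]
    · simp

end IncidenceCoalgebra

/-! ### Combinatorics of subcoalgebras of incidence coalgebras -/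

namespace IncSub

variable {K : Type w} [Field K] {X : Type u} [PartialOrder X] [LocallyFiniteOrder X]
  (C : Subcoalgebra K (IncidenceCoalgebra K X))

/-- `x ≤ y` and `e_{x,y} ∈ C`. -/
def Mem (x y : X) : Prop := ∃ h : x ≤ y, seg K h ∈ C.toSubmodule

/-- The elements `a` of `X` with `e_{a,a} ∈ C`. -/
def vertices : Set X := {a | Mem C a a}

/-- `R(C)`: the `a` with `e_{a,a} ∈ C` for which `{x | a ≤ x, e_{a,x} ∈ C}` is finite with a
unique maximal element. -/
def R : Set X := {a | a ∈ vertices C ∧ {x | Mem C a x}.Finite ∧ ∃! x, Maximal (Mem C a) x}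

/-- `L(C)`: the `a` with `e_{a,a} ∈ C` for which `{x | x ≤ a, e_{x,a} ∈ C}` is finite with a
unique minimal element. -/
def L : Set X :=
  {a | a ∈ vertices C ∧ {x | Mem C x a}.Finite ∧ ∃! x, Minimal (fun x => Mem C x a) x}

/-- `r(a)`, the maximal element of `{x | a ≤ x, e_{a,x} ∈ C}` for `a ∈ R(C)`. -/
noncomputable def r (a : R C) : X := a.2.2.2.exists.choose

/-- `l(a)`, the minimal element of `{x | x ≤ a, e_{x,a} ∈ C}` for `a ∈ L(C)`. -/
noncomputable def l (a : L C) : X := a.2.2.2.exists.choose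

/-- `U_{x,y}`, the set of `u` with `x ≤ u ≤ y` and `e_{x,u}, e_{u,y} ∈ C`. -/
def U (x y : X) : Set X := {u | Mem C x u ∧ Mem C u y}

/-- The relation `∼` on `U_{x,y}`: `u ∼ v` if they are joined by a chain
`u = u₀, u₁, …, uₙ = v` in `U_{x,y}`, `n ≥ 1`, in which any two consecutive elements have a
common lower bound in `U_{x,y}`. -/
def uSetoid (x y : X) : Setoid (U C x y) where
  r := Relation.TransGen fun u v => ∃ z : U C x y, z ≤ u ∧ z ≤ v
  iseqv :=
    { refl := fun u => Relation.TransGen.single ⟨u, le_rfl, le_rfl⟩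
      symm := fun {u v} h => by
        induction h with
        | single h =>
          obtain ⟨z, h1, h2⟩ := h
          exact Relation.TransGen.single ⟨z, h2, h1⟩
        | tail _ h ih =>
          obtain ⟨z, h1, h2⟩ := h
          exact Relation.TransGen.head ⟨z, h2, h1⟩ ih
      trans := Relation.TransGen.trans }

/-- `U_{x,y}/∼`. -/
abbrev UQuot (x y : X) : Type u := Quotient (uSetoid C x y)

/-- The class in `U_{x,y}/∼` of an element of `U_{x,y}`. -/
def uClass {x y : X} (u : U C x y) : UQuot C x y := Quotient.mk (uSetoid C x y) u

/-- `(U_{x,y}/∼)₀`: the classes `𝒞` such that, for all `u ∈ 𝒞` and `v ∈ X`: if `v ≤ u` and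
`e_{v,y} ∈ C` then `x ≤ v`, and if `u ≤ v` and `e_{x,v} ∈ C` then `v ≤ y`. -/
def UQuot₀ (x y : X) : Set (UQuot C x y) :=
  {c | (∀ u : U C x y, uClass C u = c → ∀ v : X, v ≤ u → Mem C v y → x ≤ v) ∧
    (∀ u : U C x y, uClass C u = c → ∀ v : X, (u : X) ≤ v → Mem C x v → v ≤ y)}

end IncSub

/-!
Both coalgebras have a basis on which `Δ(s) = ∑ q ⊗ r` runs over the factorizations `s = q r` of a
cancellative associative partial product (`FactorBasis`). Every subcoalgebra considered here is
spanned by part of this basis and inherits the structure (`FactorBasis.restrict`); for incidence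
coalgebras this needs `IncSub.le_span`, which cuts elements down to their components by convolving
with the dual basis elements of the trivial segments.

A `C*`-linear map `φ : C → C*` is the same as a bilinear form `β(q, p) = φ(q)(p)` which is balanced:
`β(q', w p'') = β(q' w, p'')`, `β(q', p) = 0` if `q' w ∈ C` but `p` does not begin with `w`, and
`β(q, p'') = 0` if `w p'' ∈ C` but `q` does not end with `w` (`FactorBasis.IsBalanced`). So `β(q, p)`
only depends on the product `q p` (for posets: on the class of the middle point in `U_{x,y}/∼`) and
vanishes outside `𝓕`, respectively outside `(U_{x,y}/∼)₀`. If `C` is left quasi-co-Frobenius, the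
coordinates of an embedding into a free module are such forms, and every basis element `q` pairs
nontrivially with some `p` under one of them, which is condition (d)
(`FactorBasis.exists_isBalanced`, `PathSub.exists_inF`, `IncSub.exists_uClass_mem`).

Condition (d) for the trivial path at a vertex `v` yields a path `x` from `v` in `𝓕 ∩ C`. All paths
of `C` from `v` are left factors of `x`, and all paths of `C` to the end of `x` are right factors of
`x` (`IsHull`); this is a reformulation of condition (c). Conversely, given such a longest path `x_v`
for each vertex `v`, let `m(q)` be the complement of `q` in `x_v`, where `v` is the source of `q`, so
that `q m(q) = x_v`. Then `m` is injective, as the end of `x_v` determines `v`, and sending `q` to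
the dual basis element of `m(q)` is an injective `C*`-linear map `C → C*`
(`FactorBasis.isLeftCoFrobenius_of_hull`).
-/

/-! ### Coalgebras with a basis of factorizable elements -/

/-- A basis of a coalgebra on which the comultiplication is the sum over all factorizations, as for
the paths of a quiver or the segments of a poset: `(q, r) ∈ fac s` means that `s` is the product
`q r`. The product is cancellative and associative; it is recorded only through its graph. -/
structure FactorBasis (K : Type*) (D : Type*) (I : Type*) [Field K] [AddCommGroup D] [Module K D]
    [Coalgebra K D] where
  /-- the basis -/
  basis : Module.Basis I K D
  /-- the factorizations of a basis element -/
  fac : I → Finset (I × I)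
  comul_basis : ∀ s, Coalgebra.comul (R := K) (basis s) =
    ∑ t ∈ fac s, basis t.1 ⊗ₜ[K] basis t.2
  left_cancel : ∀ {q r r' s}, (q, r) ∈ fac s → (q, r') ∈ fac s → r = r'
  right_cancel : ∀ {q q' r s}, (q, r) ∈ fac s → (q', r) ∈ fac s → q = q'
  assoc_left : ∀ {q r s a b}, (q, r) ∈ fac s → (a, b) ∈ fac q →
    ∃ t, (a, t) ∈ fac s ∧ (b, r) ∈ fac t
  assoc_right : ∀ {a t s b r}, (a, t) ∈ fac s → (b, r) ∈ fac t →
    ∃ q, (q, r) ∈ fac s ∧ (a, b) ∈ fac q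

namespace Subcoalgebra

variable {K : Type*} [Field K] {D : Type*} [AddCommGroup D] [Module K D] [Coalgebra K D]
  (C : Subcoalgebra K D)

theorem rid_lTensor_comul_mem (f : D →ₗ[K] K) {c : D} (hc : c ∈ C.toSubmodule) :
    TensorProduct.rid K D (f.lTensor D (Coalgebra.comul c)) ∈ C.toSubmodule := by
  obtain ⟨t, ht⟩ := C.comul_mem c hc
  rw [← ht]
  clear ht
  induction t with
  | zero => simp
  | add a b ha hb => simpa only [map_add] using add_mem ha hb
  | tmul a b => simpa using C.toSubmodule.smul_mem _ a.2

theorem lid_rTensor_comul_mem (f : D →ₗ[K] K) {c : D} (hc : c ∈ C.toSubmodule) :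
    TensorProduct.lid K D (f.rTensor D (Coalgebra.comul c)) ∈ C.toSubmodule := by
  obtain ⟨t, ht⟩ := C.comul_mem c hc
  rw [← ht]
  clear ht
  induction t with
  | zero => simp
  | add a b ha hb => simpa only [map_add] using add_mem ha hb
  | tmul a b => simpa using C.toSubmodule.smul_mem _ b.2

end Subcoalgebra

namespace Module.Basis

variable {K I M : Type*} [Field K] [AddCommGroup M] [Module K M]

/-- The elements of a basis that lie in a subspace spanned by them are a basis of the subspace. -/
noncomputable def restrictSubmodule (e : Module.Basis I K M)
    (N : Submodule K M) (hN : N ≤ Submodule.span K (e '' {i | e i ∈ N})) :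
    Module.Basis {i // e i ∈ N} K N :=
  Module.Basis.mk (v := fun i => (⟨e i.1, i.2⟩ : N))
    (LinearIndependent.of_comp N.subtype
      (e.linearIndependent.comp Subtype.val Subtype.val_injective))
    (by
      rintro ⟨c, hc⟩ -
      have h := hN hc
      have himg : e '' {i | e i ∈ N} =
          N.subtype '' Set.range (fun i : {i // e i ∈ N} => (⟨e i.1, i.2⟩ : N)) := by
        ext m
        simp only [Set.mem_image, Set.mem_ofPred_eq, Set.mem_range, Submodule.subtype_apply]
        constructor
        · rintro ⟨i, hi, rfl⟩
          exact ⟨_, ⟨⟨i, hi⟩, rfl⟩, rfl⟩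
        · rintro ⟨_, ⟨i, rfl⟩, rfl⟩
          exact ⟨i.1, i.2, rfl⟩
      rw [himg, ← Submodule.map_span] at h
      obtain ⟨d, hd, rfl⟩ := h
      exact hd)

theorem coe_restrictSubmodule (e : Module.Basis I K M)
    (N : Submodule K M) (hN : N ≤ Submodule.span K (e '' {i | e i ∈ N})) (i : {i // e i ∈ N}) :
    (restrictSubmodule e N hN i : M) = e i.1 := by
  simp [restrictSubmodule]

end Module.Basis

namespace FactorBasis

variable {K : Type*} [Field K] {D : Type*} [AddCommGroup D] [Module K D] [Coalgebra K D]
  {I : Type*} (F : FactorBasis K D I)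

theorem left_mem (C : Subcoalgebra K D) {s q r : I} (hs : F.basis s ∈ C.toSubmodule)
    (h : (q, r) ∈ F.fac s) : F.basis q ∈ C.toSubmodule := by
  classical
  have h1 := C.rid_lTensor_comul_mem (F.basis.coord r) hs
  rw [F.comul_basis, map_sum, map_sum, Finset.sum_eq_single (q, r)] at h1
  · simpa using h1
  · rintro ⟨q', r'⟩ ht hne
    have : r' ≠ r := by
      rintro rfl
      exact hne (by rw [F.right_cancel h ht])
    simp [Finsupp.single_eq_of_ne this.symm]
  · exact fun h2 => absurd h h2

theorem right_mem (C : Subcoalgebra K D) {s q r : I} (hs : F.basis s ∈ C.toSubmodule)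
    (h : (q, r) ∈ F.fac s) : F.basis r ∈ C.toSubmodule := by
  classical
  have h1 := C.lid_rTensor_comul_mem (F.basis.coord q) hs
  rw [F.comul_basis, map_sum, map_sum, Finset.sum_eq_single (q, r)] at h1
  · simpa using h1
  · rintro ⟨q', r'⟩ ht hne
    have : q' ≠ q := by
      rintro rfl
      exact hne (by rw [F.left_cancel h ht])
    simp [Finsupp.single_eq_of_ne this.symm]
  · exact fun h2 => absurd h h2

/-- A subcoalgebra spanned by elements of a basis with factorizations inherits such a basis: all
factors of its basis elements lie in it. -/
noncomputable def restrict (C : Subcoalgebra K D)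
    (hC : C.toSubmodule ≤ Submodule.span K (F.basis '' {i | F.basis i ∈ C.toSubmodule})) :
    FactorBasis K C.Carrier {i // F.basis i ∈ C.toSubmodule} where
  basis := Module.Basis.restrictSubmodule F.basis C.toSubmodule hC
  fac s := (F.fac s.1).preimage (Prod.map Subtype.val Subtype.val)
    (Subtype.val_injective.prodMap Subtype.val_injective).injOn
  comul_basis s := by
    refine C.incl_injective ?_
    have h := C.incl_comulRestrict (Module.Basis.restrictSubmodule F.basis C.toSubmodule hC s)
    refine h.trans ?_
    rw [Module.Basis.coe_restrictSubmodule, F.comul_basis, map_sum]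
    simp only [TensorProduct.map_tmul, Submodule.subtype_apply, Module.Basis.coe_restrictSubmodule]
    refine (Finset.sum_preimage (Prod.map Subtype.val Subtype.val) (F.fac s.1) _
      (fun t => F.basis t.1 ⊗ₜ[K] F.basis t.2) ?_).symm
    rintro ⟨q, r⟩ ht hn
    exact absurd ⟨(⟨q, F.left_mem C s.2 ht⟩, ⟨r, F.right_mem C s.2 ht⟩), rfl⟩ hn
  left_cancel h h' := by
    simp only [Finset.mem_preimage, Prod.map_apply] at h h'
    exact Subtype.ext (F.left_cancel h h')
  right_cancel h h' := by
    simp only [Finset.mem_preimage, Prod.map_apply] at h h'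
    exact Subtype.ext (F.right_cancel h h')
  assoc_left {q r s a b} h h' := by
    simp only [Finset.mem_preimage, Prod.map_apply] at h h' ⊢
    obtain ⟨t, h1, h2⟩ := F.assoc_left h h'
    exact ⟨⟨t, F.right_mem C s.2 h1⟩, h1, h2⟩
  assoc_right {a t s b r} h h' := by
    simp only [Finset.mem_preimage, Prod.map_apply] at h h' ⊢
    obtain ⟨q, h1, h2⟩ := F.assoc_right h h'
    exact ⟨⟨q, F.left_mem C s.2 h1⟩, h1, h2⟩

theorem mem_fac_restrict {C : Subcoalgebra K D}
    {hC : C.toSubmodule ≤ Submodule.span K (F.basis '' {i | F.basis i ∈ C.toSubmodule})}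
    {q r s : {i // F.basis i ∈ C.toSubmodule}} :
    (q, r) ∈ (F.restrict C hC).fac s ↔ (q.1, r.1) ∈ F.fac s.1 := by
  simp [restrict]

/-! ### Balanced bilinear forms -/

theorem leftHit_basis (f : D →ₗ[K] K) (s : I) :
    leftHit K D f (F.basis s) = ∑ t ∈ F.fac s, f (F.basis t.2) • F.basis t.1 := by
  simp [leftHit, F.comul_basis]

theorem convMul_basis (f g : DualAlg K D) (s : I) :
    (f * g).ofConv (F.basis s) =
      ∑ t ∈ F.fac s, f.ofConv (F.basis t.1) * g.ofConv (F.basis t.2) := by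
  have e : (f * g).ofConv (F.basis s) = LinearMap.mul' K K
    (TensorProduct.map f.ofConv g.ofConv (Coalgebra.comul (F.basis s))) := rfl
  simp [e, F.comul_basis]

/-- The matrix `β` of a `D*`-balanced bilinear form on `D` with respect to a basis with
factorizations: `β q p` depends only on the product `q p` as far as its factors can be shifted,
and it vanishes where they cannot be. -/
structure IsBalanced (β : I → I → K) : Prop where
  shift : ∀ {q' w q p p''}, (q', w) ∈ F.fac q → (w, p'') ∈ F.fac p → β q' p = β q p''
  exists_right : ∀ {q' w q p}, (q', w) ∈ F.fac q → β q' p ≠ 0 → ∃ p'', (w, p'') ∈ F.fac p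
  exists_left : ∀ {w p'' p q}, (w, p'') ∈ F.fac p → β q p'' ≠ 0 → ∃ q', (q', w) ∈ F.fac q

/-- A matrix is balanced once it satisfies the balance identity against every dual basis element. -/
theorem isBalanced_of_sum_eq [DecidableEq I] {β : I → I → K}
    (h : ∀ w q p, ∑ t ∈ F.fac q, (if t.2 = w then β t.1 p else 0) =
      ∑ t ∈ F.fac p, if t.1 = w then β q t.2 else 0) : F.IsBalanced β := by
  have hl : ∀ {q' w q} p, (q', w) ∈ F.fac q →
      ∑ t ∈ F.fac q, (if t.2 = w then β t.1 p else 0) = β q' p := by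
    intro q' w q p hq
    rw [Finset.sum_eq_single (q', w)]
    · simp
    · rintro ⟨a, b⟩ ht hne
      refine if_neg ?_
      rintro rfl
      exact hne (by rw [F.right_cancel hq ht])
    · exact fun h2 => absurd hq h2
  have hr : ∀ {w p'' p} q, (w, p'') ∈ F.fac p →
      ∑ t ∈ F.fac p, (if t.1 = w then β q t.2 else 0) = β q p'' := by
    intro w p'' p q hp
    rw [Finset.sum_eq_single (w, p'')]
    · simp
    · rintro ⟨a, b⟩ ht hne
      refine if_neg ?_
      rintro rfl
      exact hne (by rw [F.left_cancel hp ht])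
    · exact fun h2 => absurd hp h2
  refine ⟨fun {q' w q p p''} hq hp => ?_, fun {q' w q p} hq hne => ?_,
    fun {w p'' p q} hp hne => ?_⟩
  · rw [← hl p hq, h, hr q hp]
  · rw [← hl p hq, h] at hne
    obtain ⟨⟨a, b⟩, ht, hab⟩ := Finset.exists_ne_zero_of_sum_ne_zero hne
    obtain rfl : a = w := by
      by_contra hn
      exact hab (if_neg hn)
    exact ⟨b, ht⟩
  · rw [← hr q hp, ← h] at hne
    obtain ⟨⟨a, b⟩, ht, hab⟩ := Finset.exists_ne_zero_of_sum_ne_zero hne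
    obtain rfl : b = w := by
      by_contra hn
      exact hab (if_neg hn)
    exact ⟨a, ht⟩

end FactorBasis

theorem IsLeftCoFrobenius.isLeftQuasiCoFrobenius {K : Type w} [Field K] {C : Type x}
    [AddCommGroup C] [Module K C] [Coalgebra K C] (h : IsLeftCoFrobenius K C) :
    IsLeftQuasiCoFrobenius K C := by
  let _ := leftDualModule K C
  obtain ⟨φ, hφ⟩ := h
  exact ⟨PUnit, Finsupp.lsingle PUnit.unit ∘ₗ φ,
    (Finsupp.single_injective PUnit.unit).comp hφ⟩

namespace FactorBasis

/-- The coordinates of an embedding into a free module are balanced forms, and no basis element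
is in the kernel of all of them. -/
theorem exists_isBalanced {K : Type w} [Field K] {D : Type x} [AddCommGroup D] [Module K D]
    [Coalgebra K D] {I : Type*} (F : FactorBasis K D I)
    (h : IsLeftQuasiCoFrobenius K D) (q : I) :
    ∃ β : I → I → K, F.IsBalanced β ∧ ∃ p, β q p ≠ 0 := by
  classical
  let _ := leftDualModule K D
  obtain ⟨ι, φ, hφ⟩ := h
  have h0 : φ (F.basis q) ≠ 0 := fun h => F.basis.ne_zero q (hφ (h.trans (map_zero φ).symm))
  obtain ⟨i, hi⟩ := Finsupp.ne_iff.1 h0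
  have hi' : (φ (F.basis q) i).ofConv ≠ 0 := fun h => hi (WithConv.ofConv_injective h)
  refine ⟨fun q p => (φ (F.basis q) i).ofConv (F.basis p), F.isBalanced_of_sum_eq ?_, ?_⟩
  · intro w q p
    let ψ : D →+ K :=
      { toFun := fun c => (φ c i).ofConv (F.basis p)
        map_zero' := by simp
        map_add' := by simp }
    have hψK : ∀ (a : K) (c : D), ψ (a • c) = a * ψ c := by
      intro a c
      have hsmul : (a • (1 : DualAlg K D)) • c = a • c := by
        change leftHit K D (a • (1 : DualAlg K D)).ofConv c = _
        rw [WithConv.ofConv_smul, map_smul, LinearMap.smul_apply]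
        exact congrArg (a • ·) (one_smul (DualAlg K D) c)
      have := φ.map_smul (a • (1 : DualAlg K D)) c
      rw [hsmul] at this
      simp [ψ, this]
    have h1 : φ (leftHit K D (F.basis.coord w) (F.basis q)) i =
        WithConv.toConv (F.basis.coord w) * φ (F.basis q) i := by
      have := φ.map_smul (WithConv.toConv (F.basis.coord w)) (F.basis q)
      exact congrArg (fun z => z i) this
    have h2 := congrArg (fun z => z.ofConv (F.basis p)) h1
    simp only [convMul_basis, leftHit_basis] at h2
    change ψ _ = _ at h2
    rw [map_sum] at h2
    simp only [hψK] at h2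
    simpa [Finsupp.single_apply, ψ] using h2
  · by_contra! hp
    exact hi' (F.basis.ext fun p => by simpa using hp p)

/-- If every basis element `q` is a left factor of some `x q`, depending only on where `q` starts,
such that every multiple `w p` of the complementary factor `p` is a right factor of `x q` and `p`
determines `x q`, then sending `q` to the dual basis element of `p` embeds `D` in `D*`. -/
theorem isLeftCoFrobenius_of_hull {K : Type w} [Field K] {D : Type x} [AddCommGroup D] [Module K D]
    [Coalgebra K D] {I : Type*} (F : FactorBasis K D I) (x : I → I)
    (hx : ∀ {q q' s}, (q', s) ∈ F.fac (x q) → x q' = x q)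
    (hleft : ∀ q, ∃ p, (q, p) ∈ F.fac (x q))
    (hright : ∀ {q p w s}, (q, p) ∈ F.fac (x q) → (w, p) ∈ F.fac s →
      ∃ q', (q', s) ∈ F.fac (x q))
    (hinj : ∀ {q q' p}, (q, p) ∈ F.fac (x q) → (q', p) ∈ F.fac (x q') → x q = x q') :
    IsLeftCoFrobenius K D := by
  classical
  let _ := leftDualModule K D
  choose m hm using hleft
  have hm_inj : Function.Injective m := by
    intro q q' h
    have h1 := hm q
    have h2 := hm q'
    rw [h] at h1
    rw [← hinj h1 h2] at h2
    exact F.right_cancel h1 h2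
  have hfwd : ∀ {q' w q}, (q', w) ∈ F.fac q → (w, m q) ∈ F.fac (m q') := by
    intro q' w q h
    obtain ⟨t, h1, h2⟩ := F.assoc_left (hm q) h
    have h3 := hm q'
    rw [hx h1] at h3
    rwa [F.left_cancel h3 h1]
  have hbwd : ∀ {w q p}, (w, m q) ∈ F.fac p → ∃ q', (q', w) ∈ F.fac q ∧ m q' = p := by
    intro w q p h
    obtain ⟨q', h1⟩ := hright (hm q) h
    obtain ⟨q₂, h2, h3⟩ := F.assoc_right h1 h
    obtain rfl := F.right_cancel (hm q) h2
    have h4 := hm q'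
    rw [hx h1] at h4
    exact ⟨q', h3, F.left_cancel h4 h1⟩
  let φ₀ : D →ₗ[K] (D →ₗ[K] K) := F.basis.constr K fun q => F.basis.coord (m q)
  have hφ₀ : ∀ q p, φ₀ (F.basis q) (F.basis p) = if p = m q then 1 else 0 := by
    intro q p
    simp [φ₀, Finsupp.single_apply]
  have hbal : ∀ (f : DualAlg K D) (c : D),
      φ₀ (leftHit K D f.ofConv c) = (f * WithConv.toConv (φ₀ c)).ofConv := by
    intro f c
    refine F.basis.ext fun p => ?_
    rw [F.convMul_basis]
    have key : φ₀.flip (F.basis p) ∘ₗ leftHit K D f.ofConv =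
        ∑ t ∈ F.fac p, f.ofConv (F.basis t.1) • φ₀.flip (F.basis t.2) := by
      refine F.basis.ext fun q => ?_
      simp only [LinearMap.comp_apply, leftHit_basis, map_sum, map_smul, LinearMap.flip_apply,
        hφ₀, LinearMap.sum_apply, LinearMap.smul_apply, smul_eq_mul, mul_ite, mul_one, mul_zero]
      rw [← Finset.sum_filter, ← Finset.sum_filter]
      -- Both sums run over the `w` such that `w` is a right factor of `q` and `p = w (m q)`.
      refine Finset.sum_bij (fun t _ => (t.2, m q)) ?_ ?_ ?_ ?_
      · rintro ⟨q', w⟩ ht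
        obtain ⟨h1, h2⟩ := Finset.mem_filter.1 ht
        subst h2
        exact Finset.mem_filter.2 ⟨hfwd h1, rfl⟩
      · rintro ⟨q', w⟩ ht ⟨q₂, w₂⟩ ht' h
        obtain ⟨ht, -⟩ := Finset.mem_filter.1 ht
        obtain ⟨ht', -⟩ := Finset.mem_filter.1 ht'
        obtain rfl : w = w₂ := congrArg Prod.fst h
        rw [F.right_cancel ht ht']
      · rintro ⟨w, r⟩ ht
        obtain ⟨h0, h⟩ := Finset.mem_filter.1 ht
        obtain rfl : m q = r := h.symm
        obtain ⟨q', h1, h2⟩ := hbwd h0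
        exact ⟨(q', w), Finset.mem_filter.2 ⟨h1, h2.symm⟩, rfl⟩
      · intros
        rfl
    simpa using LinearMap.congr_fun key c
  refine ⟨{ toFun := fun c => WithConv.toConv (φ₀ c)
            map_add' := by simp
            map_smul' := fun f c => WithConv.ofConv_injective (hbal f c) }, ?_⟩
  refine (injective_iff_map_eq_zero _).2 fun c hc => ?_
  have hc' : φ₀ c = 0 := congrArg WithConv.ofConv hc
  refine F.basis.ext_elem fun q => ?_
  have h1 : φ₀ c (F.basis (m q)) = F.basis.repr c q := by
    have key : φ₀.flip (F.basis (m q)) = F.basis.coord q := by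
      refine F.basis.ext fun q' => ?_
      simp [hφ₀, hm_inj.eq_iff, Finsupp.single_apply, eq_comm]
    exact LinearMap.congr_fun key c
  simpa [hc'] using h1.symm
end FactorBasis

/-! ### Path subcoalgebras -/

section PathFactor

variable {V : Type u} [Quiver.{v} V]

/-- Two factorizations of the same path are comparable: the first factor of one of them is a left
factor of the first factor of the other. -/
theorem Quiver.Path.exists_comp_eq_of_comp_eq_comp {a b c d : V} {q : Quiver.Path a c}
    {p : Quiver.Path c b} {q' : Quiver.Path a d} {p' : Quiver.Path d b}
    (h : q.comp p = q'.comp p') :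
    (∃ s : Quiver.Path c d, q' = q.comp s ∧ p = s.comp p') ∨
      ∃ s : Quiver.Path d c, q = q'.comp s ∧ p' = s.comp p := by
  induction p with
  | nil => exact Or.inr ⟨p', h, rfl⟩
  | cons p e ih =>
    cases p' with
    | nil => exact Or.inl ⟨p.cons e, h.symm, rfl⟩
    | cons p' f =>
      rw [Quiver.Path.comp_cons, Quiver.Path.comp_cons] at h
      cases Quiver.Path.obj_eq_of_cons_eq_cons h
      cases eq_of_heq (Quiver.Path.hom_heq_of_cons_eq_cons h)
      rcases ih (eq_of_heq (Quiver.Path.heq_of_cons_eq_cons h)) with ⟨s, h1, rfl⟩ | ⟨s, h1, rfl⟩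
      · exact Or.inl ⟨s, h1, rfl⟩
      · exact Or.inr ⟨s, h1, rfl⟩

open scoped Classical in
/-- The factorizations of a path into two paths. -/
noncomputable def pathFac (s : TotalPath V) : Finset (TotalPath V × TotalPath V) :=
  ((pathSplits s.2.2).map fun t =>
    ((⟨s.1, t.1, t.2.1⟩, ⟨t.1, s.2.1, t.2.2⟩) : TotalPath V × TotalPath V)).toFinset

theorem mem_pathFac {q r s : TotalPath V} :
    (q, r) ∈ pathFac s ↔ ∃ (a c b : V) (q' : Quiver.Path a c) (r' : Quiver.Path c b),
      q = ⟨a, c, q'⟩ ∧ r = ⟨c, b, r'⟩ ∧ s = ⟨a, b, q'.comp r'⟩ := by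
  obtain ⟨a, b, s⟩ := s
  simp only [pathFac, List.mem_toFinset, List.mem_map, mem_pathSplits]
  constructor
  · rintro ⟨⟨c, q', r'⟩, h, h'⟩
    obtain ⟨rfl, rfl⟩ := Prod.mk.inj h'
    subst h
    exact ⟨a, c, b, q', r', rfl, rfl, rfl⟩
  · rintro ⟨a', c, b', q', r', rfl, rfl, h⟩
    cases h
    exact ⟨⟨c, q', r'⟩, rfl, rfl⟩

theorem comp_mem_pathFac {a b c : V} (q : Quiver.Path a c) (r : Quiver.Path c b) :
    ((⟨a, c, q⟩, ⟨c, b, r⟩) : TotalPath V × TotalPath V) ∈ pathFac ⟨a, b, q.comp r⟩ :=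
  mem_pathFac.2 ⟨a, c, b, q, r, rfl, rfl, rfl⟩

/-- The basis of paths of the path coalgebra, with the factorizations of paths. -/
noncomputable def pathFactorBasis (K : Type w) [Field K] (V : Type u) [Quiver.{v} V] :
    FactorBasis K (PathCoalgebra K V) (TotalPath V) where
  basis := pathBasis K V
  fac := pathFac
  comul_basis := by
    classical
    rintro ⟨a, b, s⟩
    refine (pathComul_pathElem K s).trans ?_
    rw [pathFac, List.sum_toFinset, List.map_map]
    · rfl
    · refine (nodup_pathSplits s).map ?_
      rintro ⟨c, q, r⟩ ⟨c', q', r'⟩ h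
      cases h
      rfl
  left_cancel h h' := by
    obtain ⟨a, c, b, q, r, rfl, rfl, rfl⟩ := mem_pathFac.1 h
    obtain ⟨a', c', b', q', r', h1, rfl, h2⟩ := mem_pathFac.1 h'
    cases h1
    simp only [Sigma.mk.injEq, heq_eq_eq, true_and] at h2
    obtain ⟨rfl, h2⟩ := h2
    rw [Quiver.Path.comp_injective_right _ (eq_of_heq h2)]
  right_cancel h h' := by
    obtain ⟨a, c, b, q, r, rfl, rfl, rfl⟩ := mem_pathFac.1 h
    obtain ⟨a', c', b', q', r', rfl, h1, h2⟩ := mem_pathFac.1 h'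
    cases h1
    simp only [Sigma.mk.injEq] at h2
    obtain ⟨rfl, h2⟩ := h2
    simp only [heq_eq_eq, Sigma.mk.injEq, true_and] at h2
    rw [Quiver.Path.comp_injective_left _ h2]
  assoc_left h h' := by
    obtain ⟨a, c, b, q, r, rfl, rfl, rfl⟩ := mem_pathFac.1 h
    obtain ⟨a', d, c', s, t, rfl, rfl, h2⟩ := mem_pathFac.1 h'
    cases h2
    refine ⟨⟨d, b, t.comp r⟩, ?_, comp_mem_pathFac t r⟩
    rw [Quiver.Path.comp_assoc]
    exact comp_mem_pathFac s (t.comp r)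
  assoc_right h h' := by
    obtain ⟨a, c, b, q, r, rfl, rfl, rfl⟩ := mem_pathFac.1 h
    obtain ⟨c', d, b', s, t, rfl, rfl, h2⟩ := mem_pathFac.1 h'
    cases h2
    refine ⟨⟨a, d, q.comp s⟩, ?_, comp_mem_pathFac q s⟩
    rw [← Quiver.Path.comp_assoc]
    exact comp_mem_pathFac (q.comp s) t

end PathFactor

namespace PathSub

variable {K : Type w} [Field K] {V : Type u} [Quiver.{v} V]
  {C : Subcoalgebra K (PathCoalgebra K V)}

theorem Mem.left {a b c : V} {q : Quiver.Path a c} {r : Quiver.Path c b}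
    (h : Mem C (q.comp r)) : Mem C q :=
  (pathFactorBasis K V).left_mem C h (comp_mem_pathFac q r)

theorem Mem.right {a b c : V} {q : Quiver.Path a c} {r : Quiver.Path c b}
    (h : Mem C (q.comp r)) : Mem C r :=
  (pathFactorBasis K V).right_mem C h (comp_mem_pathFac q r)

theorem Mem.source {a b : V} {q : Quiver.Path a b} (h : Mem C q) : a ∈ vertices C :=
  Mem.left (q := .nil) (r := q) (by rwa [Quiver.Path.nil_comp])

theorem Mem.target {a b : V} {q : Quiver.Path a b} (h : Mem C q) : b ∈ vertices C :=
  Mem.right (q := q) (r := .nil) h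

theorem IsPathSubcoalgebra.le_span (hC : IsPathSubcoalgebra C) :
    C.toSubmodule ≤ Submodule.span K ((pathFactorBasis K V).basis ''
      {i | (pathFactorBasis K V).basis i ∈ C.toSubmodule}) := by
  obtain ⟨S, hS⟩ := hC
  refine hS.le.trans (Submodule.span_mono (Set.image_mono fun i hi => ?_))
  change pathBasis K V i ∈ C.toSubmodule
  rw [hS]
  exact Submodule.subset_span (Set.mem_image_of_mem _ hi)

/-- The index of a path of `C` in the basis of `C` by paths. -/
def Mem.idx {a b : V} {q : Quiver.Path a b} (h : Mem C q) :
    {i // (pathFactorBasis K V).basis i ∈ C.toSubmodule} :=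
  ⟨⟨a, b, q⟩, h⟩

/-- `x` is the longest path of `C` at both of its ends: the paths of `C` from its source are left
factors of `x` and the paths of `C` to its target are right factors of `x`. -/
structure IsHull (C : Subcoalgebra K (PathCoalgebra K V)) {a b : V} (x : Quiver.Path a b) :
    Prop where
  mem : Mem C x
  left : ∀ {d} {q : Quiver.Path a d}, Mem C q → ∃ p : Quiver.Path d b, q.comp p = x
  right : ∀ {d} {p : Quiver.Path d b}, Mem C p → ∃ q : Quiver.Path a d, q.comp p = x

theorem IsHull.eq {a a' b : V} {x : Quiver.Path a b} {x' : Quiver.Path a' b}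
    (hx : IsHull C x) (hx' : IsHull C x') :
    (⟨a, b, x⟩ : TotalPath V) = ⟨a', b, x'⟩ := by
  obtain ⟨u, rfl⟩ := hx.right hx'.mem
  obtain ⟨u', h⟩ := hx'.right hx.mem
  have hu : u.length = 0 := by
    have := congrArg Quiver.Path.length h
    simp only [Quiver.Path.length_comp] at this
    omega
  cases u with
  | nil => rw [Quiver.Path.nil_comp]
  | cons u e => simp at hu

/-- Sending `q` to the dual basis element of the path `p` for which `q p` is the longest path from the
source of `q` embeds `C` in `C*`. -/
theorem isLeftCoFrobenius_of_isHull (hC : IsPathSubcoalgebra C)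
    (h : ∀ a ∈ vertices C, ∃ (b : V) (x : Quiver.Path a b), IsHull C x) :
    IsLeftCoFrobenius K C.Carrier := by
  choose b x hx using h
  let F := (pathFactorBasis K V).restrict C hC.le_span
  let y : {i // (pathFactorBasis K V).basis i ∈ C.toSubmodule} →
      {i // (pathFactorBasis K V).basis i ∈ C.toSubmodule} :=
    fun i => Mem.idx (hx i.1.1 (Mem.source (q := i.1.2.2) i.2)).mem
  have hy : ∀ i j, i.1.1 = j.1.1 → y i = y j := by
    rintro ⟨⟨a, c, q⟩, hq⟩ ⟨⟨a', c', q'⟩, hq'⟩ h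
    obtain rfl : a = a' := h
    rfl
  refine F.isLeftCoFrobenius_of_hull y ?_ ?_ ?_ ?_
  · intro q q' s h
    rw [FactorBasis.mem_fac_restrict] at h
    obtain ⟨a, c, d, q₀, s₀, h1, h2, h3⟩ := mem_pathFac.1 h
    refine hy _ _ ?_
    rw [h1]
    exact (congrArg Sigma.fst h3).symm
  · rintro ⟨⟨a, c, q⟩, hq⟩
    have hh := hx a (Mem.source hq)
    obtain ⟨p, hp⟩ := hh.left hq
    refine ⟨Mem.idx (Mem.right (hp.symm ▸ hh.mem)), ?_⟩
    rw [FactorBasis.mem_fac_restrict]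
    have := comp_mem_pathFac q p
    rwa [hp] at this
  · rintro ⟨⟨a, c, q⟩, hq⟩ p w ⟨⟨d, e, s⟩, hs⟩ h h'
    rw [FactorBasis.mem_fac_restrict] at h h'
    have hh := hx a (Mem.source hq)
    obtain ⟨a₁, c₁, e₁, q₁, p₁, -, h2, h3⟩ := mem_pathFac.1 h
    obtain ⟨d₂, c₂, e₂, w₂, p₂, -, h5, h6⟩ := mem_pathFac.1 h'
    rw [h2] at h5
    obtain rfl : e₁ = e₂ := congrArg (fun t => t.2.1) h5
    obtain rfl : e = e₁ := congrArg (fun t => t.2.1) h6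
    obtain rfl : b a (Mem.source hq) = e := congrArg (fun t => t.2.1) h3
    obtain ⟨q', hq'⟩ := hh.right hs
    refine ⟨Mem.idx (Mem.left (hq'.symm ▸ hh.mem)), ?_⟩
    rw [FactorBasis.mem_fac_restrict]
    have := comp_mem_pathFac q' s
    rwa [hq'] at this
  · rintro ⟨⟨a, c, q⟩, hq⟩ ⟨⟨a', c', q'⟩, hq'⟩ p h h'
    rw [FactorBasis.mem_fac_restrict] at h h'
    obtain ⟨a₁, c₁, e₁, q₁, p₁, -, h2, h3⟩ := mem_pathFac.1 h
    obtain ⟨a₂, c₂, e₂, q₂, p₂, -, h5, h6⟩ := mem_pathFac.1 h'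
    rw [h2] at h5
    obtain rfl : e₁ = e₂ := congrArg (fun t => t.2.1) h5
    have hb : b a (Mem.source hq) = b a' (Mem.source hq') :=
      (congrArg (fun t => t.2.1) h3).trans (congrArg (fun t => t.2.1) h6).symm
    have hh := hx a (Mem.source hq)
    have hh' := hx a' (Mem.source hq')
    refine Subtype.ext ?_
    change (⟨a, b a (Mem.source hq), x a (Mem.source hq)⟩ : TotalPath V) =
      ⟨a', b a' (Mem.source hq'), x a' (Mem.source hq')⟩
    generalize x a (Mem.source hq) = y₁ at hh
    generalize x a' (Mem.source hq') = y₂ at hh'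
    generalize b a (Mem.source hq) = b₁ at *
    subst hb
    exact hh.eq hh'

/-- A balanced form that does not vanish on `(q, p)` forces `q p ∈ 𝓕`: it takes the same nonzero
value on all factorizations of `q p`, since any two of them differ by a shift. -/
theorem exists_inF (hC : IsPathSubcoalgebra C) (h : IsLeftQuasiCoFrobenius K C.Carrier)
    {a c : V} {q : Quiver.Path a c} (hq : Mem C q) :
    ∃ (b : V) (p : Quiver.Path c b), Mem C p ∧ InF C (q.comp p) := by
  obtain ⟨β, hβ, ⟨⟨c', b, p⟩, hp⟩, hne⟩ :=
    ((pathFactorBasis K V).restrict C hC.le_span).exists_isBalanced h hq.idx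
  have hmk : ∀ {a b c : V} {q : Quiver.Path a c} {r : Quiver.Path c b} (h : Mem C (q.comp r)),
      (h.left.idx, h.right.idx) ∈ ((pathFactorBasis K V).restrict C hC.le_span).fac h.idx := by
    intro a b c q r h
    rw [FactorBasis.mem_fac_restrict]
    exact comp_mem_pathFac q r
  obtain rfl : c = c' := by
    obtain ⟨r, hr⟩ := hβ.exists_right (hmk (r := .nil) hq) hne
    rw [FactorBasis.mem_fac_restrict] at hr
    obtain ⟨c₁, c₂, b₁, n, r', h1, -, h3⟩ := mem_pathFac.1 hr
    exact (congrArg Sigma.fst h1).trans (congrArg Sigma.fst h3).symm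
  have hall : ∀ {d : V} {q' : Quiver.Path a d} {p' : Quiver.Path d b} (hq' : Mem C q')
      (hp' : Mem C p'), q'.comp p' = q.comp p → β hq'.idx hp'.idx ≠ 0 := by
    intro d q' p' hq' hp' h'
    rcases Quiver.Path.exists_comp_eq_of_comp_eq_comp h' with ⟨s, rfl, rfl⟩ | ⟨s, rfl, rfl⟩
    · rw [hβ.shift (hmk hq) (hmk hp')]
      exact hne
    · rw [← hβ.shift (hmk hq') (hmk hp)]
      exact hne
  refine ⟨b, p, hp, ⟨c, q, p, hq, hp, rfl⟩, ?_, ?_⟩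
  · intro d q' p' hq' hp' h' e α hα
    obtain ⟨r, hr⟩ := hβ.exists_left (hmk hα) (hall hq' hp' h')
    rw [FactorBasis.mem_fac_restrict] at hr
    obtain ⟨a₁, e₁, d₁, r', α', h1, h2, h3⟩ := mem_pathFac.1 hr
    cases h2
    cases h3
    exact ⟨r', rfl⟩
  · intro d q' p' hq' hp' h' e γ hγ
    obtain ⟨r, hr⟩ := hβ.exists_right (hmk (q := q') (r := γ.toPath) hγ) (hall hq' hp' h')
    rw [FactorBasis.mem_fac_restrict] at hr
    obtain ⟨d₁, e₁, b₁, γ', r', h1, h2, h3⟩ := mem_pathFac.1 hr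
    cases h1
    cases h3
    exact ⟨r', rfl⟩

/-- An element `x` of `𝓕` that lies in `C` has the factorizations `x = q p` with `q` any left factor,
so a path of `C` from its source can be followed arrow by arrow along `x`, and dually. -/
theorem InF.isHull {a b : V} {x : Quiver.Path a b} (hx : Mem C x) (h : InF C x) :
    IsHull C x := by
  refine ⟨hx, ?_, ?_⟩
  · intro d q hq
    induction q with
    | nil => exact ⟨x, Quiver.Path.nil_comp x⟩
    | cons q e ih =>
      have hq' : Mem C q := Mem.left (r := e.toPath) hq
      obtain ⟨p, rfl⟩ := ih hq'
      obtain ⟨p', rfl⟩ := h.2.2 _ q p hq' hx.right rfl _ e hq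
      exact ⟨p', (Quiver.Path.comp_assoc q e.toPath p').symm ▸ rfl⟩
  · intro d p hp
    obtain ⟨n, hn⟩ : ∃ n, p.length = n := ⟨_, rfl⟩
    induction n generalizing d with
    | zero =>
      obtain rfl := Quiver.Path.eq_of_length_zero p hn
      obtain rfl := Quiver.Path.eq_nil_of_length_zero p hn
      exact ⟨x, rfl⟩
    | succ n ih =>
      obtain ⟨e, α, p', hn', rfl⟩ := p.eq_toPath_comp_of_length_eq_succ hn
      obtain ⟨q, hq⟩ := ih hp.right hn'
      obtain ⟨q', rfl⟩ := h.2.1 _ q p' (Mem.left (hq.symm ▸ hx)) hp.right hq _ α hp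
      exact ⟨q', by rw [← hq, ← Quiver.Path.comp_assoc]; rfl⟩

theorem exists_isHull_of_inF
    (h : ∀ (a c : V) (q : Quiver.Path a c), Mem C q →
      ∃ (b : V) (p : Quiver.Path c b), Mem C p ∧ InF C (q.comp p)) (a : V) (ha : a ∈ vertices C) :
    ∃ (b : V) (x : Quiver.Path a b), IsHull C x := by
  obtain ⟨b, p, hp, hF⟩ := h a a .nil ha
  rw [Quiver.Path.nil_comp] at hF
  exact ⟨b, p, hF.isHull hp⟩

theorem IsHull.isMaxFrom_iff {a b : V} {x : Quiver.Path a b} (hx : IsHull C x)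
    (p : Σ b : V, Quiver.Path a b) : IsMaxFrom C a p ↔ p = ⟨b, x⟩ := by
  constructor
  · rintro ⟨hp, hmax⟩
    exact (hmax ⟨b, x⟩ hx.mem (hx.left hp)).symm
  · rintro rfl
    refine ⟨hx.mem, ?_⟩
    rintro ⟨c, q⟩ hq ⟨r, hr'⟩
    change Quiver.Path b c at r
    obtain rfl : x.comp r = q := hr'
    obtain ⟨s, hs⟩ := hx.left hq
    have hr : r.length = 0 := by
      have := congrArg Quiver.Path.length hs
      simp only [Quiver.Path.length_comp] at this
      omega
    cases r with
    | nil => rfl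
    | cons r e => simp at hr

theorem IsHull.isMaxTo_iff {a b : V} {x : Quiver.Path a b} (hx : IsHull C x)
    (p : Σ a : V, Quiver.Path a b) : IsMaxTo C b p ↔ p = ⟨a, x⟩ := by
  constructor
  · rintro ⟨hp, hmax⟩
    exact (hmax ⟨a, x⟩ hx.mem (hx.right hp)).symm
  · rintro rfl
    refine ⟨hx.mem, ?_⟩
    rintro ⟨c, q⟩ hq ⟨r, hr'⟩
    change Quiver.Path c a at r
    obtain rfl : r.comp x = q := hr'
    obtain ⟨s, hs⟩ := hx.right hq
    have hr : r.length = 0 := by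
      have := congrArg Quiver.Path.length hs
      simp only [Quiver.Path.length_comp] at this
      omega
    cases r with
    | nil => rw [Quiver.Path.nil_comp]
    | cons r e => simp at hr

theorem IsHull.mem_R {a b : V} {x : Quiver.Path a b} (hx : IsHull C x) : a ∈ R C := by
  refine ⟨hx.mem.source, ?_, ⟨b, x⟩, (hx.isMaxFrom_iff _).2 rfl,
    fun p hp => (hx.isMaxFrom_iff p).1 hp⟩
  refine (List.finite_toSet ((pathSplits x).map fun t =>
    (⟨t.1, t.2.1⟩ : Σ b : V, Quiver.Path a b))).subset ?_
  rintro ⟨c, q⟩ hq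
  obtain ⟨p, hp⟩ := hx.left hq
  exact List.mem_map.2 ⟨⟨c, q, p⟩, (mem_pathSplits x _).2 hp, rfl⟩

theorem IsHull.mem_L {a b : V} {x : Quiver.Path a b} (hx : IsHull C x) : b ∈ L C := by
  refine ⟨hx.mem.target, ?_, ⟨a, x⟩, (hx.isMaxTo_iff _).2 rfl,
    fun p hp => (hx.isMaxTo_iff p).1 hp⟩
  refine (List.finite_toSet ((pathSplits x).map fun t =>
    (⟨t.1, t.2.2⟩ : Σ a : V, Quiver.Path a b))).subset ?_
  rintro ⟨c, p⟩ hp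
  obtain ⟨q, hq⟩ := hx.right hp
  exact List.mem_map.2 ⟨⟨c, q, p⟩, (mem_pathSplits x _).2 hq, rfl⟩

theorem IsHull.r_eq {a b : V} {x : Quiver.Path a b} (hx : IsHull C x) (ha : a ∈ R C) :
    r C ⟨a, ha⟩ = b :=
  congrArg Sigma.fst ((hx.isMaxFrom_iff _).1 ha.2.2.exists.choose_spec)

theorem IsHull.l_eq {a b : V} {x : Quiver.Path a b} (hx : IsHull C x) (hb : b ∈ L C) :
    l C ⟨b, hb⟩ = a :=
  congrArg Sigma.fst ((hx.isMaxTo_iff _).1 hb.2.2.exists.choose_spec)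

theorem left_factor_of_isMaxFrom {a : V} (ha : a ∈ R C) {p : Σ b : V, Quiver.Path a b}
    (hp : IsMaxFrom C a p) {d : V} {q : Quiver.Path a d} (hq : Mem C q) :
    ∃ t : Quiver.Path d p.1, q.comp t = p.2 := by
  -- A longest path of `C` among those extending `q` is maximal.
  obtain ⟨z, ⟨hz, t, ht⟩, hmax⟩ := Set.exists_max_image
    {z ∈ pathsFrom C a | ∃ t : Quiver.Path d z.1, q.comp t = z.2} (fun z => z.2.length)
    (ha.2.1.subset (Set.sep_subset _ _)) ⟨⟨d, q⟩, hq, .nil, rfl⟩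
  obtain rfl : z = p := by
    refine ha.2.2.unique ⟨hz, ?_⟩ hp
    obtain ⟨c, z⟩ := z
    rintro ⟨e, y⟩ hy ⟨s, hs⟩
    change Quiver.Path c e at s
    obtain rfl : z.comp s = y := hs
    have h1 := hmax ⟨e, z.comp s⟩ ⟨hy, t.comp s, by
      rw [← Quiver.Path.comp_assoc, ht]⟩
    simp only [Quiver.Path.length_comp] at h1
    cases s with
    | nil => rfl
    | cons s e => simp at h1
  exact ⟨t, ht⟩

theorem right_factor_of_isMaxTo {b : V} (hb : b ∈ L C) {p : Σ a : V, Quiver.Path a b}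
    (hp : IsMaxTo C b p) {d : V} {q : Quiver.Path d b} (hq : Mem C q) :
    ∃ t : Quiver.Path p.1 d, t.comp q = p.2 := by
  obtain ⟨z, ⟨hz, t, ht⟩, hmax⟩ := Set.exists_max_image
    {z ∈ pathsTo C b | ∃ t : Quiver.Path z.1 d, t.comp q = z.2} (fun z => z.2.length)
    (hb.2.1.subset (Set.sep_subset _ _)) ⟨⟨d, q⟩, hq, .nil, Quiver.Path.nil_comp q⟩
  obtain rfl : z = p := by
    refine hb.2.2.unique ⟨hz, ?_⟩ hp
    obtain ⟨c, z⟩ := z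
    rintro ⟨e, y⟩ hy ⟨s, hs⟩
    change Quiver.Path e c at s
    obtain rfl : s.comp z = y := hs
    have h1 := hmax ⟨e, s.comp z⟩ ⟨hy, s.comp t, by
      rw [Quiver.Path.comp_assoc, ht]⟩
    simp only [Quiver.Path.length_comp] at h1
    cases s with
    | nil => rw [Quiver.Path.nil_comp]
    | cons s e =>
      simp at h1
  exact ⟨t, ht⟩

theorem exists_isMaxFrom_r (a : R C) :
    ∃ x : Quiver.Path (a : V) (r C a), IsMaxFrom C a ⟨r C a, x⟩ :=
  ⟨a.2.2.2.exists.choose.2, a.2.2.2.exists.choose_spec⟩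

theorem exists_isMaxTo_l (b : L C) :
    ∃ x : Quiver.Path (l C b) (b : V), IsMaxTo C b ⟨l C b, x⟩ :=
  ⟨b.2.2.2.exists.choose.2, b.2.2.2.exists.choose_spec⟩

theorem exists_isHull_of_r_l (hR : R C = vertices C) (h : ∀ a : R C, r C a ∈ L C)
    (hl : ∀ a : R C, l C ⟨r C a, h a⟩ = a) (a : V) (ha : a ∈ vertices C) :
    ∃ (b : V) (x : Quiver.Path a b), IsHull C x := by
  have haR : a ∈ R C := hR ▸ ha
  obtain ⟨x, hx⟩ := exists_isMaxFrom_r ⟨a, haR⟩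
  obtain ⟨y, hy⟩ := exists_isMaxTo_l ⟨r C ⟨a, haR⟩, h _⟩
  have hla := hl ⟨a, haR⟩
  generalize l C ⟨r C ⟨a, haR⟩, h _⟩ = a' at y hy hla
  obtain rfl : a' = a := hla
  -- `x` is a right factor of `y`, and `y` is a left factor of `x`.
  obtain rfl : x = y := by
    obtain ⟨t, ht⟩ := right_factor_of_isMaxTo (h _) hy hx.1
    obtain ⟨s, hs⟩ := left_factor_of_isMaxFrom haR hx hy.1
    have h1 := congrArg Quiver.Path.length ht
    have h2 := congrArg Quiver.Path.length hs
    simp only [Quiver.Path.length_comp] at h1 h2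
    obtain rfl := t.eq_nil_of_length_zero (by omega)
    exact (Quiver.Path.nil_comp x).symm.trans ht
  exact ⟨_, x, hx.1, left_factor_of_isMaxFrom haR hx, right_factor_of_isMaxTo (h _) hy⟩

theorem tfae (hC : IsPathSubcoalgebra C) :
    List.TFAE [
      IsLeftCoFrobenius K C.Carrier,
      IsLeftQuasiCoFrobenius K C.Carrier,
      R C = vertices C ∧
        ∃ h : ∀ a : R C, r C a ∈ L C, ∀ a : R C, l C ⟨r C a, h a⟩ = a,
      ∀ (a c : V) (q : Quiver.Path a c), Mem C q →
        ∃ (b : V) (p : Quiver.Path c b), Mem C p ∧ InF C (q.comp p)] := by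
  tfae_have 1 → 2 := IsLeftCoFrobenius.isLeftQuasiCoFrobenius
  tfae_have 2 → 4 := fun h a c q hq => exists_inF hC h hq
  tfae_have 4 → 3 := by
    intro h
    have hull := exists_isHull_of_inF h
    refine ⟨Set.Subset.antisymm (fun a ha => ha.1) fun a ha => ?_, ?_, ?_⟩
    · obtain ⟨b, x, hx⟩ := hull a ha
      exact hx.mem_R
    · rintro ⟨a, ha⟩
      obtain ⟨b, x, hx⟩ := hull a ha.1
      rw [hx.r_eq]
      exact hx.mem_L
    · rintro ⟨a, ha⟩
      obtain ⟨b, x, hx⟩ := hull a ha.1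
      obtain rfl := hx.r_eq ha
      exact hx.l_eq _
  tfae_have 3 → 1 := fun ⟨hR, h, hl⟩ =>
    isLeftCoFrobenius_of_isHull hC (exists_isHull_of_r_l hR h hl)
  tfae_finish

end PathSub

/-! ### Subcoalgebras of incidence coalgebras -/

section SegFactor

variable {X : Type u} [PartialOrder X] [LocallyFiniteOrder X]

open scoped Classical in
/-- The factorizations `e_{x,z} e_{z,y}` of a segment `e_{x,y}`. -/
noncomputable def segFac (s : {p : X × X // p.1 ≤ p.2}) :
    Finset ({p : X × X // p.1 ≤ p.2} × {p : X × X // p.1 ≤ p.2}) :=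
  (Finset.Icc s.1.1 s.1.2).attach.image fun z : {z // z ∈ Finset.Icc s.1.1 s.1.2} =>
    (⟨(s.1.1, z), (Finset.mem_Icc.1 z.2).1⟩, ⟨(z, s.1.2), (Finset.mem_Icc.1 z.2).2⟩)

theorem mem_segFac {q r s : {p : X × X // p.1 ≤ p.2}} :
    (q, r) ∈ segFac s ↔ q.1.1 = s.1.1 ∧ q.1.2 = r.1.1 ∧ r.1.2 = s.1.2 := by
  simp only [segFac, Finset.mem_image, Finset.mem_attach, true_and]
  constructor
  · rintro ⟨z, h⟩
    obtain ⟨rfl, rfl⟩ := Prod.mk.inj h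
    exact ⟨rfl, rfl, rfl⟩
  · obtain ⟨⟨x, y⟩, h⟩ := s
    obtain ⟨⟨a, b⟩, hq⟩ := q
    obtain ⟨⟨c, d⟩, hr⟩ := r
    rintro ⟨h1, h2, h3⟩
    dsimp only at h1 h2 h3
    subst h1 h2 h3
    exact ⟨⟨b, Finset.mem_Icc.2 ⟨hq, hr⟩⟩, rfl⟩

/-- The basis of segments of the incidence coalgebra, with the factorizations of segments. -/
noncomputable def segFactorBasis (K : Type w) [Field K] (X : Type u) [PartialOrder X]
    [LocallyFiniteOrder X] :
    FactorBasis K (IncidenceCoalgebra K X) {p : X × X // p.1 ≤ p.2} where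
  basis := segBasis K X
  fac := segFac
  comul_basis := by
    classical
    rintro ⟨⟨x, y⟩, h⟩
    refine (segComul_seg K h).trans ?_
    rw [segFac, Finset.sum_image]
    · rfl
    · rintro ⟨z, hz⟩ - ⟨z', hz'⟩ - h
      simpa using h
  left_cancel {q r r' s} h h' := by
    rw [mem_segFac] at h h'
    exact Subtype.ext (Prod.ext (h.2.1.symm.trans h'.2.1) (h.2.2.trans h'.2.2.symm))
  right_cancel {q q' r s} h h' := by
    rw [mem_segFac] at h h'
    exact Subtype.ext (Prod.ext (h.1.trans h'.1.symm) (h.2.1.trans h'.2.1.symm))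
  assoc_left {q r s a b} h h' := by
    rw [mem_segFac] at h h'
    refine ⟨⟨(b.1.1, r.1.2), b.2.trans ((h'.2.2.trans h.2.1).le.trans r.2)⟩,
      mem_segFac.2 ⟨h'.1.trans h.1, h'.2.1, h.2.2⟩, mem_segFac.2 ⟨rfl, h'.2.2.trans h.2.1, rfl⟩⟩
  assoc_right {a t s b r} h h' := by
    rw [mem_segFac] at h h'
    refine ⟨⟨(a.1.1, b.1.2), a.2.trans ((h.2.1.trans h'.1.symm).le.trans b.2)⟩,
      mem_segFac.2 ⟨h.1, h'.2.1, h'.2.2.trans h.2.2⟩,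
      mem_segFac.2 ⟨rfl, h.2.1.trans h'.1.symm, rfl⟩⟩

end SegFactor

namespace IncSub

variable {K : Type w} [Field K] {X : Type u} [PartialOrder X] [LocallyFiniteOrder X]
  {C : Subcoalgebra K (IncidenceCoalgebra K X)}

theorem Mem.le {x y : X} (h : Mem C x y) : x ≤ y := h.1

theorem Mem.left {x y z : X} (h : Mem C x y) (hxz : x ≤ z) (hzy : z ≤ y) : Mem C x z :=
  ⟨hxz, (segFactorBasis K X).left_mem C h.2
    ((mem_segFac (q := ⟨(x, z), hxz⟩) (r := ⟨(z, y), hzy⟩)).2 ⟨rfl, rfl, rfl⟩)⟩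

theorem Mem.right {x y z : X} (h : Mem C x y) (hxz : x ≤ z) (hzy : z ≤ y) : Mem C z y :=
  ⟨hzy, (segFactorBasis K X).right_mem C h.2
    ((mem_segFac (q := ⟨(x, z), hxz⟩) (r := ⟨(z, y), hzy⟩)).2 ⟨rfl, rfl, rfl⟩)⟩

theorem Mem.source {x y : X} (h : Mem C x y) : x ∈ vertices C := h.left le_rfl h.le

theorem Mem.target {x y : X} (h : Mem C x y) : y ∈ vertices C := h.right h.le le_rfl

/-- Convolving with the dual basis elements of `e_{x,x}` and `e_{y,y}` on both sides cuts an element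
down to its `e_{x,y}`-component, so a subcoalgebra contains the components of its elements. -/
theorem repr_smul_seg_mem {c : IncidenceCoalgebra K X} (hc : c ∈ C.toSubmodule)
    (i : {p : X × X // p.1 ≤ p.2}) :
    (segBasis K X).repr c i • segBasis K X i ∈ C.toSubmodule := by
  classical
  obtain ⟨⟨x, y⟩, h⟩ := i
  let F := segFactorBasis K X
  let f : IncidenceCoalgebra K X →ₗ[K] K := F.basis.coord ⟨(x, x), le_rfl⟩
  let g : IncidenceCoalgebra K X →ₗ[K] K := F.basis.coord ⟨(y, y), le_rfl⟩
  let G : IncidenceCoalgebra K X →ₗ[K] IncidenceCoalgebra K X :=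
    (TensorProduct.rid K _).toLinearMap ∘ₗ g.lTensor _ ∘ₗ Coalgebra.comul
  let H : IncidenceCoalgebra K X →ₗ[K] IncidenceCoalgebra K X :=
    (TensorProduct.lid K _).toLinearMap ∘ₗ f.rTensor _ ∘ₗ Coalgebra.comul
  have hG : ∀ s, G (F.basis s) = if s.1.2 = y then F.basis s else 0 := by
    intro s
    simp only [G, LinearMap.comp_apply, LinearEquiv.coe_coe, F.comul_basis, map_sum,
      LinearMap.lTensor_tmul, TensorProduct.rid_tmul]
    rw [Finset.sum_eq_single (s, ⟨(s.1.2, s.1.2), le_rfl⟩)]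
    · simp only [g, Module.Basis.coord_apply, Module.Basis.repr_self, Finsupp.single_apply,
        Subtype.mk.injEq, Prod.mk.injEq, and_self, ite_smul, one_smul, zero_smul]
    · rintro ⟨q, r⟩ ht hne
      have ht' := mem_segFac.1 ht
      have hr : r ≠ ⟨(y, y), le_rfl⟩ := by
        rintro rfl
        refine hne (Prod.ext (Subtype.ext (Prod.ext ht'.1 (ht'.2.1.trans ht'.2.2))) ?_)
        exact Subtype.ext (Prod.ext ht'.2.2 ht'.2.2)
      simp [g, Finsupp.single_eq_of_ne hr.symm]
    · exact fun hn => (hn (mem_segFac.2 ⟨rfl, rfl, rfl⟩)).elim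
  have hH : ∀ s, H (F.basis s) = if s.1.1 = x then F.basis s else 0 := by
    intro s
    simp only [H, LinearMap.comp_apply, LinearEquiv.coe_coe, F.comul_basis, map_sum,
      LinearMap.rTensor_tmul, TensorProduct.lid_tmul]
    rw [Finset.sum_eq_single (⟨(s.1.1, s.1.1), le_rfl⟩, s)]
    · simp only [f, Module.Basis.coord_apply, Module.Basis.repr_self, Finsupp.single_apply,
        Subtype.mk.injEq, Prod.mk.injEq, and_self, ite_smul, one_smul, zero_smul]
    · rintro ⟨q, r⟩ ht hne
      have ht' := mem_segFac.1 ht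
      have hq : q ≠ ⟨(x, x), le_rfl⟩ := by
        rintro rfl
        refine hne (Prod.ext ?_ (Subtype.ext (Prod.ext (ht'.2.1.symm.trans ht'.1) ht'.2.2)))
        exact Subtype.ext (Prod.ext ht'.1 ht'.1)
      simp [f, Finsupp.single_eq_of_ne hq.symm]
    · exact fun hn => (hn (mem_segFac.2 ⟨rfl, rfl, rfl⟩)).elim
  have key : H ∘ₗ G = (F.basis.coord ⟨(x, y), h⟩).smulRight (F.basis ⟨(x, y), h⟩) := by
    refine F.basis.ext fun s => ?_
    obtain ⟨⟨a, b⟩, hs⟩ := s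
    rw [LinearMap.comp_apply, hG, apply_ite H, hH, map_zero]
    simp only [LinearMap.smulRight_apply, Module.Basis.coord_apply, Module.Basis.repr_self,
      Finsupp.single_apply, Subtype.mk.injEq, Prod.mk.injEq, ite_smul, one_smul, zero_smul]
    by_cases ha : a = x
    · by_cases hb : b = y
      · subst ha hb
        simp
      · simp [hb]
    · simp [ha]
  have h1 : H (G c) ∈ C.toSubmodule := C.lid_rTensor_comul_mem f (C.rid_lTensor_comul_mem g hc)
  have h2 := LinearMap.congr_fun key c
  rw [LinearMap.comp_apply] at h2
  rw [h2] at h1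
  exact h1

/-- Every subcoalgebra of an incidence coalgebra is spanned by segments. -/
theorem le_span (C : Subcoalgebra K (IncidenceCoalgebra K X)) :
    C.toSubmodule ≤ Submodule.span K ((segFactorBasis K X).basis ''
      {i | (segFactorBasis K X).basis i ∈ C.toSubmodule}) := by
  intro c hc
  rw [← (segBasis K X).linearCombination_repr c]
  refine Submodule.sum_mem _ fun i hi => Submodule.smul_mem _ _ (Submodule.subset_span ?_)
  refine ⟨i, ?_, rfl⟩
  have h := C.toSubmodule.smul_mem ((segBasis K X).repr c i)⁻¹ (repr_smul_seg_mem hc i)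
  rwa [smul_smul, inv_mul_cancel₀ (Finsupp.mem_support_iff.1 hi), one_smul] at h

/-- The index of a segment of `C` in the basis of `C` by segments. -/
def Mem.idx {x y : X} (h : Mem C x y) :
    {i // (segFactorBasis K X).basis i ∈ C.toSubmodule} :=
  ⟨⟨(x, y), h.1⟩, h.2⟩

/-- `e_{a,b}` is the longest segment of `C` at both of its ends: `b` is the greatest `x` with
`e_{a,x} ∈ C`, and `a` is the least `x` with `e_{x,b} ∈ C`. -/
structure IsHull (C : Subcoalgebra K (IncidenceCoalgebra K X)) (a b : X) : Prop where
  mem : Mem C a b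
  le_right : ∀ {z}, Mem C a z → z ≤ b
  left_le : ∀ {z}, Mem C z b → a ≤ z

theorem IsHull.eq {a a' b : X} (h : IsHull C a b) (h' : IsHull C a' b) : a = a' :=
  le_antisymm (h.left_le h'.mem) (h'.left_le h.mem)

/-- Sending `e_{a,z}` to the dual basis element of `e_{z,b}`, where `e_{a,b}` is the longest segment of
`C` from `a`, embeds `C` in `C*`. -/
theorem isLeftCoFrobenius_of_isHull (h : ∀ a ∈ vertices C, ∃ b, IsHull C a b) :
    IsLeftCoFrobenius K C.Carrier := by
  choose b hb using h
  have hidx : ∀ i : {i // (segFactorBasis K X).basis i ∈ C.toSubmodule},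
      Mem C i.1.1.1 i.1.1.2 := fun i => ⟨i.1.2, i.2⟩
  let y : {i // (segFactorBasis K X).basis i ∈ C.toSubmodule} →
      {i // (segFactorBasis K X).basis i ∈ C.toSubmodule} :=
    fun i => Mem.idx (hb i.1.1.1 (hidx i).source).mem
  have hy : ∀ i j, i.1.1.1 = j.1.1.1 → y i = y j := by
    rintro ⟨⟨⟨a, c⟩, hac⟩, hq⟩ ⟨⟨⟨a', c'⟩, hac'⟩, hq'⟩ h
    obtain rfl : a = a' := h
    rfl
  refine ((segFactorBasis K X).restrict C (le_span C)).isLeftCoFrobenius_of_hull y ?_ ?_ ?_ ?_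
  · intro q q' s h
    rw [FactorBasis.mem_fac_restrict] at h
    exact hy _ _ (mem_segFac.1 h).1
  · intro q
    have hh := hb q.1.1.1 (hidx q).source
    refine ⟨Mem.idx (hh.mem.right q.1.2 (hh.le_right (hidx q))), ?_⟩
    rw [FactorBasis.mem_fac_restrict]
    exact mem_segFac.2 ⟨rfl, rfl, rfl⟩
  · intro q p w s h h'
    rw [FactorBasis.mem_fac_restrict] at h h'
    have h1 := mem_segFac.1 h
    have h2 := mem_segFac.1 h'
    have hh := hb q.1.1.1 (hidx q).source
    have hs : s.1.1.2 = b q.1.1.1 (hidx q).source := h2.2.2.symm.trans h1.2.2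
    have hs' : Mem C s.1.1.1 (b q.1.1.1 (hidx q).source) := hs ▸ hidx s
    refine ⟨Mem.idx (hh.mem.left (hh.left_le hs') hs'.le), ?_⟩
    rw [FactorBasis.mem_fac_restrict]
    exact mem_segFac.2 ⟨rfl, rfl, hs⟩
  · intro q q' p h h'
    rw [FactorBasis.mem_fac_restrict] at h h'
    have hh := hb q.1.1.1 (hidx q).source
    have hh' := hb q'.1.1.1 (hidx q').source
    have hbb : b q.1.1.1 (hidx q).source = b q'.1.1.1 (hidx q').source :=
      (mem_segFac.1 h).2.2.symm.trans (mem_segFac.1 h').2.2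
    rw [← hbb] at hh'
    exact hy _ _ (hh.eq hh')

/-- A balanced form that does not vanish on `(e_{x,z}, e_{z,y})` takes nonzero values at all
elements of the class of `z`, since related elements differ by shifts; hence the class lies in
`(U_{x,y}/∼)₀`. -/
theorem exists_uClass_mem (h : IsLeftQuasiCoFrobenius K C.Carrier) {a z : X} (hz : Mem C a z) :
    ∃ (y : X) (hy : Mem C z y), uClass C (⟨z, hz, hy⟩ : U C a y) ∈ UQuot₀ C a y := by
  obtain ⟨β, hβ, ⟨⟨⟨z', y⟩, hzy'⟩, hp⟩, hne⟩ :=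
    ((segFactorBasis K X).restrict C (le_span C)).exists_isBalanced h hz.idx
  have hmk : ∀ {x z y : X} (h1 : Mem C x z) (h2 : Mem C z y) (h : Mem C x y),
      (h1.idx, h2.idx) ∈ ((segFactorBasis K X).restrict C (le_span C)).fac h.idx := by
    intro x z y h1 h2 h
    rw [FactorBasis.mem_fac_restrict]
    exact mem_segFac.2 ⟨rfl, rfl, rfl⟩
  obtain rfl : z = z' := by
    obtain ⟨r, hr⟩ := hβ.exists_right (hmk hz hz.target hz) hne
    rw [FactorBasis.mem_fac_restrict] at hr
    exact (mem_segFac.1 hr).1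
  have hy : Mem C z y := ⟨hzy', hp⟩
  replace hne : β hz.idx hy.idx ≠ 0 := hne
  have hle : ∀ u v : U C a y, u ≤ v → β u.2.1.idx u.2.2.idx = β v.2.1.idx v.2.2.idx := by
    intro u v huv
    have huv' : Mem C u.1 v.1 := u.2.2.left huv v.2.2.le
    exact hβ.shift (hmk u.2.1 huv' v.2.1) (hmk huv' v.2.2 u.2.2)
  have hall : ∀ u : U C a y, uClass C u = uClass C ⟨z, hz, hy⟩ →
      β u.2.1.idx u.2.2.idx ≠ 0 := by
    intro u hu
    have hrel : Relation.TransGen (fun u v : U C a y => ∃ w : U C a y, w ≤ u ∧ w ≤ v) u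
      ⟨z, hz, hy⟩ := Quotient.exact hu
    induction hrel using Relation.TransGen.head_induction_on with
    | single h =>
      obtain ⟨w, h1, h2⟩ := h
      rw [← hle _ _ h1, hle _ _ h2]
      exact hne
    | head h _ ih =>
      obtain ⟨w, h1, h2⟩ := h
      rw [← hle _ _ h1, hle _ _ h2]
      exact ih (Quotient.sound ‹_›)
  refine ⟨y, hy, fun u hu v hvu hvy => ?_, fun u hu v huv hav => ?_⟩
  · obtain ⟨r, hr⟩ := hβ.exists_left (hmk (hvy.left hvu u.2.2.le) u.2.2 hvy) (hall u hu)
    rw [FactorBasis.mem_fac_restrict] at hr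
    have h1 := mem_segFac.1 hr
    exact (h1.1.symm.le.trans r.1.2).trans h1.2.1.le
  · obtain ⟨r, hr⟩ := hβ.exists_right (hmk u.2.1 (hav.right u.2.1.le huv) hav) (hall u hu)
    rw [FactorBasis.mem_fac_restrict] at hr
    have h1 := mem_segFac.1 hr
    exact (h1.2.1.le.trans r.1.2).trans h1.2.2.le

theorem exists_isHull_of_uClass
    (h : ∀ (a z : X) (hz : Mem C a z), ∃ (y : X) (hy : Mem C z y),
      uClass C (⟨z, hz, hy⟩ : U C a y) ∈ UQuot₀ C a y) (a : X) (ha : a ∈ vertices C) :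
    ∃ b, IsHull C a b := by
  obtain ⟨y, hy, h1, h2⟩ := h a a ha
  refine ⟨y, hy, fun {z} hz => h2 _ rfl z hz.le hz, fun {z} hz => ?_⟩
  -- `a` is a common lower bound of `a` and `y`, so `y` lies in the class of `a`.
  exact h1 ⟨y, hy, hy.target⟩
    (Quotient.sound (Relation.TransGen.single ⟨⟨a, ha, hy⟩, hy.le, le_rfl⟩)) z hz.le hz

theorem IsHull.maximal_iff {a b : X} (h : IsHull C a b) (x : X) : Maximal (Mem C a) x ↔ x = b :=
  ⟨fun hx => hx.eq_of_le h.mem (h.le_right hx.prop),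
    fun hx => hx ▸ ⟨h.mem, fun _ hz _ => h.le_right hz⟩⟩

theorem IsHull.minimal_iff {a b : X} (h : IsHull C a b) (x : X) :
    Minimal (fun x => Mem C x b) x ↔ x = a :=
  ⟨fun hx => (hx.eq_of_le h.mem (h.left_le hx.prop)).symm,
    fun hx => hx ▸ ⟨h.mem, fun _ hz _ => h.left_le hz⟩⟩

theorem IsHull.mem_R {a b : X} (h : IsHull C a b) : a ∈ R C :=
  ⟨h.mem.source, (Set.finite_Icc a b).subset fun _ hx => ⟨hx.le, h.le_right hx⟩,
    b, (h.maximal_iff b).2 rfl, fun x hx => (h.maximal_iff x).1 hx⟩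

theorem IsHull.mem_L {a b : X} (h : IsHull C a b) : b ∈ L C :=
  ⟨h.mem.target, (Set.finite_Icc a b).subset fun _ hx => ⟨h.left_le hx, hx.le⟩,
    a, (h.minimal_iff a).2 rfl, fun x hx => (h.minimal_iff x).1 hx⟩

theorem maximal_r (a : R C) : Maximal (Mem C a) (r C a) := a.2.2.2.exists.choose_spec

theorem minimal_l (b : L C) : Minimal (fun x => Mem C x b) (l C b) := b.2.2.2.exists.choose_spec

theorem IsHull.r_eq {a b : X} (h : IsHull C a b) (ha : a ∈ R C) : r C ⟨a, ha⟩ = b :=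
  (h.maximal_iff _).1 (maximal_r ⟨a, ha⟩)

theorem IsHull.l_eq {a b : X} (h : IsHull C a b) (hb : b ∈ L C) : l C ⟨b, hb⟩ = a :=
  (h.minimal_iff _).1 (minimal_l ⟨b, hb⟩)

theorem le_r (a : R C) {z : X} (hz : Mem C a z) : z ≤ r C a := by
  obtain ⟨m, hzm, hm⟩ := a.2.2.1.exists_le_maximal hz
  rwa [← a.2.2.2.unique hm (maximal_r a)]

theorem l_le (b : L C) {z : X} (hz : Mem C z b) : l C b ≤ z := by
  obtain ⟨m, hmz, hm⟩ := b.2.2.1.exists_le_minimal hz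
  rwa [← b.2.2.2.unique hm (minimal_l b)]

theorem tfae (C : Subcoalgebra K (IncidenceCoalgebra K X)) :
    List.TFAE [
      IsLeftCoFrobenius K C.Carrier,
      IsLeftQuasiCoFrobenius K C.Carrier,
      R C = vertices C ∧
        ∃ h : ∀ a : R C, r C a ∈ L C, ∀ a : R C, l C ⟨r C a, h a⟩ = a,
      ∀ (a z : X) (hz : Mem C a z), ∃ (y : X) (hy : Mem C z y),
        uClass C (⟨z, hz, hy⟩ : U C a y) ∈ UQuot₀ C a y] := by
  tfae_have 1 → 2 := IsLeftCoFrobenius.isLeftQuasiCoFrobenius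
  tfae_have 2 → 4 := fun h a z hz => exists_uClass_mem h hz
  tfae_have 4 → 3 := by
    intro h
    have hull := exists_isHull_of_uClass h
    refine ⟨Set.Subset.antisymm (fun a ha => ha.1) fun a ha => ?_, ?_, ?_⟩
    · obtain ⟨b, hb⟩ := hull a ha
      exact hb.mem_R
    · rintro ⟨a, ha⟩
      obtain ⟨b, hb⟩ := hull a ha.1
      rw [hb.r_eq]
      exact hb.mem_L
    · rintro ⟨a, ha⟩
      obtain ⟨b, hb⟩ := hull a ha.1
      obtain rfl := hb.r_eq ha
      exact hb.l_eq _
  tfae_have 3 → 1 := by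
    rintro ⟨hR, h, hl⟩
    refine isLeftCoFrobenius_of_isHull fun a ha => ?_
    have haR : a ∈ R C := hR ▸ ha
    refine ⟨r C ⟨a, haR⟩, (maximal_r ⟨a, haR⟩).prop, fun hz => le_r ⟨a, haR⟩ hz, fun hz => ?_⟩
    have := l_le ⟨_, h ⟨a, haR⟩⟩ hz
    rwa [hl] at this
  tfae_finish

end IncSub

theorem propositionp (K : Type w) [Field K] :
    (∀ (V : Type u) [Quiver.{v} V] (C : Subcoalgebra K (PathCoalgebra K V)),
      PathSub.IsPathSubcoalgebra C →
      List.TFAE [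
        IsLeftCoFrobenius K C.Carrier,
        IsLeftQuasiCoFrobenius K C.Carrier,
        PathSub.R C = PathSub.vertices C ∧
          ∃ h : ∀ a : PathSub.R C, PathSub.r C a ∈ PathSub.L C,
            ∀ a : PathSub.R C, PathSub.l C ⟨PathSub.r C a, h a⟩ = a,
        ∀ (a c : V) (q : Quiver.Path a c), PathSub.Mem C q →
          ∃ (b : V) (p : Quiver.Path c b), PathSub.Mem C p ∧ PathSub.InF C (q.comp p)]) ∧
    (∀ (X : Type x) [PartialOrder X] [LocallyFiniteOrder X]
      (C : Subcoalgebra K (IncidenceCoalgebra K X)),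
      List.TFAE [
        IsLeftCoFrobenius K C.Carrier,
        IsLeftQuasiCoFrobenius K C.Carrier,
        IncSub.R C = IncSub.vertices C ∧
          ∃ h : ∀ a : IncSub.R C, IncSub.r C a ∈ IncSub.L C,
            ∀ a : IncSub.R C, IncSub.l C ⟨IncSub.r C a, h a⟩ = a,
        ∀ (a z : X) (hz : IncSub.Mem C a z),
          ∃ (y : X) (hy : IncSub.Mem C z y),
            IncSub.uClass C (⟨z, hz, hy⟩ : IncSub.U C a y) ∈ IncSub.UQuot₀ C a y]) :=
  ⟨fun _ _ _ hC => PathSub.tfae hC, fun _ _ _ C => IncSub.tfae C⟩
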